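/- Let $n > 2$ and let $L = \sum_{k=1}^{n} a_k(x) D^k$, $D = d/dx$, where each $a_k$ is a real polynomial of degree at most $k$ and $a_n \not\equiv 0$. Let $I \subseteq \mathbb{R}$ be a nondegenerate interval (bounded or unbounded), and let $p$ be an admissible weight on $I$: $p$ is $C^\infty$ and positive on $I$ except at finitely many points, and $\int_I p\,|u|\,dx < \infty$ for every polynomial $u$. Suppose that $L$ is self-adjoint with respect to $\langle u, v\rangle = \int_I p\,u\,v\,dx$, that is, $\langle Ly, u\rangle = \langle y, Lu\rangle$ for all $C^\infty$ functions $y, u : \mathbb{R} \to \mathbb{R}$ all of whose derivatives (including those of order $0$) have at most polynomial growth. Then for every real root $r$ of $a_n$, the multiplicity of $r$ as a root of $a_n$ is at least $2$, and the multiplicity of $r$ as a root of $a_{n-1}$ is positive and strictly smaller than its multiplicity as a root of $a_n$ (in particular $a_{n-1} \not\equiv 0$). -/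

import Mathlib

open Polynomial MeasureTheory
open scoped ContDiff

noncomputable section

/-- The differential operator `L = ∑_{k=1}^n a_k(x) D^k` with polynomial coefficients. -/
def polyDiffOp (n : ℕ) (a : ℕ → ℝ[X]) (y : ℝ → ℝ) (x : ℝ) : ℝ :=
  ∑ k ∈ Finset.Icc 1 n, (a k).eval x * iteratedDeriv k y x

/-- `L = ∑_{k=1}^n a_k(x) D^k` is of order `n` (its leading coefficient does not vanish
identically) and each `a_k` has degree at most `k`, so that `L` maps the polynomials of degree
at most `N` to themselves, for every `N`. -/
structure IsPolyDiffOpOfOrder (n : ℕ) (a : ℕ → ℝ[X]) : Prop where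
  leading_ne_zero : a n ≠ 0
  natDegree_le : ∀ k ∈ Finset.Icc 1 n, (a k).natDegree ≤ k

/-- An admissible weight on a set `I` (in use, a nondegenerate interval, bounded or not, with
or without its endpoints): positive and smooth off finitely many points of `I`, with all
polynomials integrable against it. No condition is put on `p` at the exceptional points or on the
limits of `p` there. -/
structure IsAdmissibleWeight (I : Set ℝ) (p : ℝ → ℝ) : Prop where
  piecewise_smooth_pos : ∃ S : Set ℝ, S.Finite ∧ ContDiffOn ℝ ∞ p (I \ S) ∧ ∀ x ∈ I \ S, 0 < p x
  integrable : ∀ u : ℝ[X], IntegrableOn (fun x => p x * u.eval x) I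

/-- The inner product `⟨u, v⟩ = ∫_I p u v dx`. -/
def weightedInner (I : Set ℝ) (p u v : ℝ → ℝ) : ℝ :=
  ∫ x in I, p x * u x * v x

/-- `L` is self-adjoint for `⟨u, v⟩ = ∫_I p u v dx`: `⟨L y, u⟩ = ⟨y, L u⟩` for smooth `y`, `u`.
The functions range over the smooth functions whose derivatives of all orders grow at most
polynomially; on these all the integrals converge for every admissible weight. They include the
polynomials and the compactly supported smooth functions, and for bounded `I` the growth
condition restricts nothing on `I`. -/
def IsSelfAdjointFor (n : ℕ) (a : ℕ → ℝ[X]) (I : Set ℝ) (p : ℝ → ℝ) : Prop :=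
  ∀ y u : ℝ → ℝ, Function.HasTemperateGrowth y → Function.HasTemperateGrowth u →
    weightedInner I p (polyDiffOp n a y) u = weightedInner I p y (polyDiffOp n a u)

end

/-!
Testing self-adjointness against bump functions turns it into the formal identity
`∑ (-D) ^ k (p a_k u) = p L u` inside `I`. Its coefficient of order `n - 1` is a first order
equation `a_n p' = N p` for the weight, where `N = (2 / n) a_{n-1} - a_n'`, and `n` is even.

Where `N / a_n` dominates `1 / x` — at a point where the equation for `p` has an irregular
singularity, or at `±∞`, where integrability of all polynomials forces it — the powers of `p' / p`
are the main contribution of each derivative of `p a_k`, so the identity becomes an invariance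
`T (-(z + c)) = T z` of a limiting symbol `T = ∑ t_k z ^ k`. Were `t_0` its only term of order
below `n`, this would be impossible, and the comparison of exponents gives `2 deg a_n ≤ n` at an
infinite end and multiplicities `n`, `n - 2` at an irregular finite endpoint.

At a regular endpoint `p` behaves like a power `x ^ s` with `s > -1`. Testing self-adjointness on
`exp (-t x)` and `x ^ j exp (-t x)` and letting `t → ∞` gives, by Watson's lemma, linear relations
with coefficients `Γ (s + 1 + i + j)` between the lowest coefficients of the `a_k`. A Hankel system
of this kind has only the trivial solution, so the multiplicity of `a_n` is at least `n / 2`.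

Since `deg a_n ≤ n`, there is no room for roots of `a_n` other than the endpoints of `I`.
-/

open Filter Topology

lemma natCast_mul_pow_sub_one_mul {R : Type*} [CommSemiring R] (i : ℕ) (x : R) :
    (i : R) * x ^ (i - 1) * x = i * x ^ i := by
  rcases i with _ | i
  · simp
  · rw [Nat.add_sub_cancel, pow_succ, mul_assoc]

lemma iteratedDeriv_polynomial_eval (u : ℝ[X]) (k : ℕ) :
    iteratedDeriv k (fun x => u.eval x) = fun x => (derivative^[k] u).eval x := by
  induction k with
  | zero => simp
  | succ k ih =>
    ext x
    rw [iteratedDeriv_succ, ih, Polynomial.deriv, Function.iterate_succ_apply']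

lemma hasTemperateGrowth_polynomial_eval (u : ℝ[X]) :
    Function.HasTemperateGrowth (fun x : ℝ => u.eval x) := by
  simp only [eval_eq_sum_range]
  fun_prop

lemma contDiff_polynomial_eval (u : ℝ[X]) : ContDiff ℝ ∞ (fun x : ℝ => u.eval x) :=
  (hasTemperateGrowth_polynomial_eval u).1

lemma eval_iterate_derivative_X_sub_C_pow {R : Type*} [CommRing R] (x : R) (m k : ℕ) :
    (derivative^[k] ((X - C x) ^ m)).eval x = if k = m then (m.factorial : R) else 0 := by
  rw [iterate_derivative_X_sub_pow]
  rcases lt_trichotomy k m with h | h | h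
  · simp [h.ne, zero_pow (Nat.sub_ne_zero_of_lt h)]
  · simp [h, Nat.descFactorial_self]
  · simp [h.ne', Nat.descFactorial_eq_zero_iff_lt.2 h]

lemma contDiffOn_iteratedDeriv {U : Set ℝ} (hU : IsOpen U) {F : ℝ → ℝ}
    (hF : ContDiffOn ℝ ∞ F U) (k : ℕ) : ContDiffOn ℝ ∞ (iteratedDeriv k F) U := by
  induction k with
  | zero => simpa
  | succ k ih =>
    rw [iteratedDeriv_succ]
    exact ih.deriv_of_isOpen hU (by simp)

lemma tsupport_iteratedDeriv_subset (y : ℝ → ℝ) (k : ℕ) :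
    tsupport (iteratedDeriv k y) ⊆ tsupport y := by
  induction k with
  | zero => simp
  | succ k ih =>
    rw [iteratedDeriv_succ]
    exact tsupport_deriv_subset.trans ih

lemma hasCompactSupport_iteratedDeriv {y : ℝ → ℝ} (hc : HasCompactSupport y) (k : ℕ) :
    HasCompactSupport (iteratedDeriv k y) :=
  hc.of_isClosed_subset (isClosed_tsupport _) (tsupport_iteratedDeriv_subset y k)

section TestFunctions

variable {U : Set ℝ} {F y : ℝ → ℝ}

lemma integrable_mul_of_tsupport_subset (hU : IsOpen U) (hF : ContinuousOn F U)
    (hy : Continuous y) (hc : HasCompactSupport y) (hyU : tsupport y ⊆ U) :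
    Integrable fun x => F x * y x := by
  have hsupp : tsupport (fun x => F x * y x) ⊆ U := tsupport_mul_subset_right.trans hyU
  have hcont : ContinuousOn (fun x => F x * y x) U := hF.mul hy.continuousOn
  exact (hcont.continuous_of_tsupport_subset hU hsupp).integrable_of_hasCompactSupport hc.mul_left

lemma integral_mul_deriv_of_tsupport_subset (hU : IsOpen U) (hF : ContDiffOn ℝ ∞ F U)
    (hy : ContDiff ℝ ∞ y) (hc : HasCompactSupport y) (hyU : tsupport y ⊆ U) :
    ∫ x, F x * deriv y x = - ∫ x, deriv F x * y x := by
  have hF' : ContinuousOn (deriv F) U := hF.continuousOn_deriv_of_isOpen hU (by simp)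
  exact integral_mul_deriv_eq_deriv_mul_of_integrable
    (fun x hx => ((hF.contDiffAt (hU.mem_nhds (hyU hx))).differentiableAt (by simp)).hasDerivAt)
    (fun x _ => (hy.differentiable (by simp)).differentiableAt.hasDerivAt)
    (integrable_mul_of_tsupport_subset hU hF.continuousOn (hy.continuous_deriv (by simp)) hc.deriv
      (tsupport_deriv_subset.trans hyU))
    (integrable_mul_of_tsupport_subset hU hF' hy.continuous hc hyU)
    (integrable_mul_of_tsupport_subset hU hF.continuousOn hy.continuous hc hyU)

lemma integral_mul_iteratedDeriv_of_tsupport_subset (hU : IsOpen U) (hF : ContDiffOn ℝ ∞ F U)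
    (hy : ContDiff ℝ ∞ y) (hc : HasCompactSupport y) (hyU : tsupport y ⊆ U) (k : ℕ) :
    ∫ x, F x * iteratedDeriv k y x = (-1) ^ k * ∫ x, iteratedDeriv k F x * y x := by
  induction k generalizing y with
  | zero => simp
  | succ k ih =>
    rw [iteratedDeriv_succ', ih (contDiff_infty_iff_deriv.1 hy).2 hc.deriv
      (tsupport_deriv_subset.trans hyU), iteratedDeriv_succ,
      integral_mul_deriv_of_tsupport_subset hU (contDiffOn_iteratedDeriv hU hF k) hy hc hyU,
      pow_succ]
    ring

lemma eqOn_of_forall_integral_mul_eq {G H : ℝ → ℝ} (hU : IsOpen U) (hG : ContinuousOn G U)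
    (hH : ContinuousOn H U)
    (h : ∀ y : ℝ → ℝ, ContDiff ℝ ∞ y → HasCompactSupport y → tsupport y ⊆ U →
      ∫ x, G x * y x = ∫ x, H x * y x) : Set.EqOn G H U := by
  have hae : ∀ᵐ x, x ∈ U → G x - H x = 0 := by
    refine hU.ae_eq_zero_of_integral_contDiff_smul_eq_zero
      ((hG.sub hH).locallyIntegrableOn hU.measurableSet) fun y hy hc hyU => ?_
    have hsub : ∀ x, y x • (G x - H x) = G x * y x - H x * y x := fun x => by
      rw [smul_eq_mul]; ring
    rw [integral_congr_ae (.of_forall hsub),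
      integral_sub (integrable_mul_of_tsupport_subset hU hG hy.continuous hc hyU)
        (integrable_mul_of_tsupport_subset hU hH hy.continuous hc hyU), h y hy hc hyU, sub_self]
  refine Measure.eqOn_open_of_ae_eq (μ := volume) ?_ hU hG hH
  exact (ae_restrict_iff' hU.measurableSet).2 (hae.mono fun x hx hxU => sub_eq_zero.1 (hx hxU))

end TestFunctions

section SelfAdjoint

variable {n : ℕ} {a : ℕ → ℝ[X]} {I U : Set ℝ} {p u y : ℝ → ℝ}

lemma polyDiffOp_eq_zero_of_notMem_tsupport {x : ℝ} (hx : x ∉ tsupport y) :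
    polyDiffOp n a y x = 0 :=
  Finset.sum_eq_zero fun k _ => by
    rw [image_eq_zero_of_notMem_tsupport fun h => hx (tsupport_iteratedDeriv_subset y k h),
      mul_zero]

lemma weightedInner_polyDiffOp_eq_integral (hU : IsOpen U) (hUI : U ⊆ I)
    (hp : ContDiffOn ℝ ∞ p U) (hu : ContDiff ℝ ∞ u) (hy : ContDiff ℝ ∞ y)
    (hc : HasCompactSupport y) (hyU : tsupport y ⊆ U) :
    weightedInner I p (polyDiffOp n a y) u = ∫ x, (∑ k ∈ Finset.Icc 1 n,
      (-1) ^ k * iteratedDeriv k (fun z => (a k).eval z * p z * u z) x) * y x := by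
  set F : ℕ → ℝ → ℝ := fun k z => (a k).eval z * p z * u z
  have hF : ∀ k, ContDiffOn ℝ ∞ (F k) U := fun k =>
    ((contDiff_polynomial_eval (a k)).contDiffOn.mul hp).mul hu.contDiffOn
  have hdist : ∀ x, p x * polyDiffOp n a y x * u x =
      ∑ k ∈ Finset.Icc 1 n, F k x * iteratedDeriv k y x := fun x => by
    rw [polyDiffOp, Finset.mul_sum, Finset.sum_mul]
    exact Finset.sum_congr rfl fun k _ => by ring
  rw [weightedInner, setIntegral_eq_integral_of_forall_compl_eq_zero fun x hx => by
    rw [polyDiffOp_eq_zero_of_notMem_tsupport fun h => hx (hUI (hyU h)), mul_zero, zero_mul]]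
  change _ = ∫ x, (∑ k ∈ Finset.Icc 1 n, (-1) ^ k * iteratedDeriv k (F k) x) * y x
  simp_rw [hdist, Finset.sum_mul, mul_assoc]
  rw [integral_finsetSum, integral_finsetSum]
  · refine Finset.sum_congr rfl fun k _ => ?_
    rw [integral_mul_iteratedDeriv_of_tsupport_subset hU (hF k) hy hc hyU, integral_const_mul]
  · exact fun k _ => (integrable_mul_of_tsupport_subset hU
      (contDiffOn_iteratedDeriv hU (hF k) k).continuousOn hy.continuous hc hyU).const_mul _
  · exact fun k _ => integrable_mul_of_tsupport_subset hU (hF k).continuousOn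
      (hy.continuous_iteratedDeriv k (by exact_mod_cast le_top))
      (hasCompactSupport_iteratedDeriv hc k) ((tsupport_iteratedDeriv_subset y k).trans hyU)

lemma IsSelfAdjointFor.formalAdjoint_eqOn (hsa : IsSelfAdjointFor n a I p) (hU : IsOpen U)
    (hUI : U ⊆ I) (hp : ContDiffOn ℝ ∞ p U) (hu : Function.HasTemperateGrowth u) :
    Set.EqOn (fun x => ∑ k ∈ Finset.Icc 1 n,
        (-1) ^ k * iteratedDeriv k (fun z => (a k).eval z * p z * u z) x)
      (fun x => p x * polyDiffOp n a u x) U := by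
  refine eqOn_of_forall_integral_mul_eq hU ?_ ?_ fun y hy hc hyU => ?_
  · exact continuousOn_finsetSum _ fun k _ => continuousOn_const.mul (contDiffOn_iteratedDeriv hU
      (((contDiff_polynomial_eval (a k)).contDiffOn.mul hp).mul hu.1.contDiffOn) k).continuousOn
  · refine hp.continuousOn.mul (continuous_finsetSum _ fun k _ => ?_).continuousOn
    exact (a k).continuous.mul (hu.1.continuous_iteratedDeriv k (by exact_mod_cast le_top))
  · have hL : weightedInner I p y (polyDiffOp n a u) =
        ∫ x, p x * polyDiffOp n a u x * y x := by
      rw [weightedInner, setIntegral_eq_integral_of_forall_compl_eq_zero fun x hx => by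
        rw [image_eq_zero_of_notMem_tsupport fun h => hx (hUI (hyU h)), mul_zero, zero_mul]]
      simp_rw [mul_right_comm]
    rw [← hL, ← hsa y u (hc.hasTemperateGrowth hy) hu,
      weightedInner_polyDiffOp_eq_integral hU hUI hp hu.1 hy hc hyU]

/-- The weight `p` is smooth and positive on the open set `U`, where `∑_{k=0}^n a_k(x) D^k`
satisfies the determining equations of a formally symmetric operator: the coefficients of `D^k` in
`u ↦ ∑_j (-1)^j D^j(a_j p u)` and in `p ∑_j a_j D^j` agree. -/
structure IsFormallySymmetricOn (n : ℕ) (a : ℕ → ℝ[X]) (p : ℝ → ℝ) (U : Set ℝ) : Prop where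
  isOpen : IsOpen U
  contDiffOn : ContDiffOn ℝ ∞ p U
  pos : ∀ x ∈ U, 0 < p x
  determining_eq : ∀ x ∈ U, ∀ k ≤ n, ∑ j ∈ Finset.Icc k n, (-1) ^ j * (j.choose k : ℝ) *
    iteratedDeriv (j - k) (fun z => (a j).eval z * p z) x = (a k).eval x * p x

/-- Leibniz' formula, evaluated at the only point where the test polynomial has a single nonzero
derivative. -/
lemma iteratedDeriv_mul_X_sub_C_pow {f : ℝ → ℝ} {x : ℝ} (hf : ContDiffAt ℝ ∞ f x) (j k : ℕ) :
    iteratedDeriv j (fun z => f z * ((X - C x) ^ k).eval z) x =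
      if k ≤ j then (j.choose k : ℝ) * iteratedDeriv (j - k) f x * k.factorial else 0 := by
  have hf' : ContDiffAt ℝ j f x := hf.of_le (by exact_mod_cast le_top)
  have hX : ContDiffAt ℝ j (fun z => ((X - C x) ^ k).eval z) x :=
    (contDiff_polynomial_eval _).contDiffAt.of_le (by exact_mod_cast le_top)
  simp_rw [mul_comm (f _)]
  rw [iteratedDeriv_fun_mul hX hf']
  simp only [iteratedDeriv_polynomial_eval, eval_iterate_derivative_X_sub_C_pow, mul_ite, mul_zero,
    ite_mul, zero_mul, Finset.sum_ite_eq', Finset.mem_range, Nat.lt_succ_iff]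
  exact if_congr Iff.rfl (by ring) rfl

lemma IsSelfAdjointFor.isFormallySymmetricOn (hsa : IsSelfAdjointFor n a I p) (h0 : a 0 = 0)
    (hU : IsOpen U) (hUI : U ⊆ I) (hp : ContDiffOn ℝ ∞ p U) (hpos : ∀ x ∈ U, 0 < p x) :
    IsFormallySymmetricOn n a p U := by
  refine ⟨hU, hp, hpos, fun x hx k hk => ?_⟩
  have hF : ∀ j, ContDiffAt ℝ ∞ (fun z => (a j).eval z * p z) x := fun j =>
    (contDiff_polynomial_eval (a j)).contDiffAt.mul (hp.contDiffAt (hU.mem_nhds hx))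
  have key := hsa.formalAdjoint_eqOn hU hUI hp
    (hasTemperateGrowth_polynomial_eval ((X - C x) ^ k)) hx
  rw [← mul_left_inj' (Nat.cast_ne_zero.2 k.factorial_ne_zero : (k.factorial : ℝ) ≠ 0)]
  calc _ = ∑ j ∈ Finset.Icc 1 n,
        (-1) ^ j * iteratedDeriv j (fun z => (a j).eval z * p z * ((X - C x) ^ k).eval z) x := by
        simp only [iteratedDeriv_mul_X_sub_C_pow (hF _), mul_ite, mul_zero]
        rw [← Finset.sum_filter, Finset.sum_mul]
        symm
        refine Finset.sum_subset_zero_on_sdiff (fun j hj => ?_) (fun j hj => ?_) fun j _ => by ring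
        · simp only [Finset.mem_filter, Finset.mem_Icc] at hj ⊢
          omega
        · have hj0 : j = 0 := by
            simp only [Finset.mem_sdiff, Finset.mem_filter, Finset.mem_Icc] at hj
            omega
          simp [hj0, h0]
    _ = p x * polyDiffOp n a (fun z => ((X - C x) ^ k).eval z) x := key
    _ = _ := by
        simp only [polyDiffOp, iteratedDeriv_polynomial_eval, eval_iterate_derivative_X_sub_C_pow,
          mul_ite, mul_zero, Finset.sum_ite_eq', Finset.mem_Icc]
        rcases k.eq_zero_or_pos with rfl | hk0
        · simp [h0]
        · rw [if_pos ⟨hk0, hk⟩]; ring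

end SelfAdjoint

/-- `f` is asymptotic to `c φ ^ e` along `l`, or `o(φ ^ e)` if `c = 0`. -/
def HasLeadingTerm (l : Filter ℝ) (φ : ℝ → ℝ) (e : ℤ) (f : ℝ → ℝ) (c : ℝ) : Prop :=
  Tendsto (fun x => f x * φ x ^ (-e)) l (𝓝 c)

/-- A place of the projective line, seen through a filter `l` and a large parameter `φ`: nonzero
polynomials have an exact order in `φ`, and differentiation raises the order by at most `τ`. -/
structure IsPlace (l : Filter ℝ) (φ : ℝ → ℝ) (τ : ℤ) : Prop where
  neBot : l.NeBot
  tendsto : Tendsto φ l atTop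
  exists_leadingTerm : ∀ f : ℝ[X], f ≠ 0 → ∃ e c, c ≠ 0 ∧ HasLeadingTerm l φ e (f.eval ·) c
  derivative : ∀ (f : ℝ[X]) (e : ℤ) (c : ℝ), HasLeadingTerm l φ e (f.eval ·) c →
    ∃ c', HasLeadingTerm l φ (e + τ) ((derivative f).eval ·) c'

namespace HasLeadingTerm

variable {l : Filter ℝ} {φ : ℝ → ℝ} {e e' : ℤ} {f g : ℝ → ℝ} {c c' : ℝ}

lemma of_lt (hφ : Tendsto φ l atTop) (h : HasLeadingTerm l φ e f c) (hlt : e < e') :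
    HasLeadingTerm l φ e' f 0 := by
  have hzero : Tendsto (fun x => φ x ^ (e - e')) l (𝓝 0) :=
    (tendsto_zpow_atTop_zero (sub_neg.2 hlt)).comp hφ
  have hmul := Tendsto.mul h hzero
  rw [mul_zero] at hmul
  refine hmul.congr' ?_
  filter_upwards [hφ.eventually_gt_atTop 0] with x hx
  rw [mul_assoc, ← zpow_add₀ hx.ne']
  congr 2; ring

lemma le [l.NeBot] (hφ : Tendsto φ l atTop) (h : HasLeadingTerm l φ e f c) (hc : c ≠ 0)
    (h' : HasLeadingTerm l φ e' f c') : e ≤ e' := by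
  by_contra! hlt
  exact hc (tendsto_nhds_unique h (h'.of_lt hφ hlt))

lemma mono (hφ : Tendsto φ l atTop) (h : HasLeadingTerm l φ e f c) (hle : e ≤ e') :
    ∃ c', HasLeadingTerm l φ e' f c' := by
  rcases hle.eq_or_lt with rfl | hlt
  · exact ⟨c, h⟩
  · exact ⟨0, h.of_lt hφ hlt⟩

lemma mul (hφ : Tendsto φ l atTop) (h : HasLeadingTerm l φ e f c)
    (h' : HasLeadingTerm l φ e' g c') :
    HasLeadingTerm l φ (e + e') (fun x => f x * g x) (c * c') := by
  refine (Tendsto.mul h h').congr' ?_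
  filter_upwards [hφ.eventually_gt_atTop 0] with x hx
  rw [neg_add, zpow_add₀ hx.ne']; ring

lemma add (h : HasLeadingTerm l φ e f c) (h' : HasLeadingTerm l φ e g c') :
    HasLeadingTerm l φ e (fun x => f x + g x) (c + c') :=
  (Tendsto.add h h').congr fun x => by ring

lemma const_mul (h : HasLeadingTerm l φ e f c) (r : ℝ) :
    HasLeadingTerm l φ e (fun x => r * f x) (r * c) :=
  (Tendsto.const_mul r h).congr fun x => by ring

lemma sum {ι : Type*} {s : Finset ι} {F : ι → ℝ → ℝ} {C : ι → ℝ}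
    (h : ∀ i ∈ s, HasLeadingTerm l φ e (F i) (C i)) :
    HasLeadingTerm l φ e (fun x => ∑ i ∈ s, F i x) (∑ i ∈ s, C i) :=
  (tendsto_finsetSum s h).congr fun x => by rw [Finset.sum_mul]

lemma div_pow (hφ : Tendsto φ l atTop) (h : HasLeadingTerm l φ e f c)
    (h' : HasLeadingTerm l φ e' g c') (hc' : c' ≠ 0) (i : ℕ) :
    HasLeadingTerm l φ (e - i * e') (fun x => f x / g x ^ i) (c / c' ^ i) := by
  refine (Tendsto.div h (Tendsto.pow h' i) (pow_ne_zero i hc')).congr' ?_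
  filter_upwards [hφ.eventually_gt_atTop 0] with x hx
  rw [Pi.div_apply, mul_pow, ← zpow_natCast (φ x ^ (-e')), ← zpow_mul, mul_div_mul_comm,
    ← zpow_sub₀ hx.ne']
  congr 2; ring

end HasLeadingTerm

lemma hasLeadingTerm_zero {l : Filter ℝ} {φ : ℝ → ℝ} {e : ℤ} :
    HasLeadingTerm l φ e (fun _ => 0) 0 := by
  simpa [HasLeadingTerm] using tendsto_const_nhds

/-- A common supporting line of slope `-κ` for the orders of `a 0, …, a n` at a place; the
polynomial `T` is the principal symbol that it cuts out. -/
lemma IsPlace.exists_supporting_line {l : Filter ℝ} {φ : ℝ → ℝ} {τ : ℤ} (hP : IsPlace l φ τ)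
    {n : ℕ} {a : ℕ → ℝ[X]} (han : a n ≠ 0) (κ : ℤ) :
    ∃ (M : ℤ) (T : ℝ[X]), T ≠ 0 ∧ T.natDegree ≤ n ∧
      ∀ k ≤ n, HasLeadingTerm l φ (M - k * κ) ((a k).eval ·) (T.coeff k) := by
  choose! E γ hγ hE using hP.exists_leadingTerm
  obtain ⟨k₀, hk₀, hmax⟩ := Finset.exists_max_image
    ((Finset.range (n + 1)).filter fun k => a k ≠ 0) (fun k => E (a k) + k * κ)
    ⟨n, by simp [han]⟩
  simp only [Finset.mem_filter, Finset.mem_range, Nat.lt_succ_iff] at hk₀ hmax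
  set M : ℤ := E (a k₀) + k₀ * κ
  have hexists : ∀ k, ∃ t, k ≤ n → HasLeadingTerm l φ (M - k * κ) ((a k).eval ·) t := fun k => by
    by_cases hk : a k = 0
    · exact ⟨0, fun _ => by simpa only [hk, eval_zero] using hasLeadingTerm_zero⟩
    · by_cases hkn : k ≤ n
      · obtain ⟨t, ht⟩ := (hE _ hk).mono hP.tendsto (le_sub_iff_add_le.2 (hmax k ⟨hkn, hk⟩))
        exact ⟨t, fun _ => ht⟩
      · exact ⟨0, fun h => absurd h hkn⟩
  choose t ht using hexists
  set T : ℝ[X] := ofFn (n + 1) fun j => t j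
  have hcoeff : ∀ k ≤ n, T.coeff k = t k := fun k hk =>
    ofFn_coeff_eq_val_of_lt _ (Nat.lt_succ_of_le hk)
  refine ⟨M, T, fun hT => hγ _ hk₀.2 ?_,
    Nat.lt_succ_iff.1 (ofFn_natDegree_lt (Nat.succ_pos n) _),
    fun k hk => (hcoeff k hk).symm ▸ ht k hk⟩
  have := hP.neBot
  have hlead : HasLeadingTerm l φ (M - k₀ * κ) ((a k₀).eval ·) (γ (a k₀)) := by
    simpa [M] using hE _ hk₀.2
  rw [tendsto_nhds_unique hlead (ht k₀ hk₀.1), ← hcoeff k₀ hk₀.1, hT, coeff_zero]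

lemma comp_neg_X_add_C_eq_self {R : Type*} [CommRing R] {T : R[X]} {n : ℕ}
    (hdeg : T.natDegree ≤ n) {c : R}
    (h : ∀ k ≤ n, ∑ j ∈ Finset.Icc k n, (-1) ^ j * (j.choose k : R) * (T.coeff j * c ^ (j - k)) =
      T.coeff k) : T.comp (-(X + C c)) = T := by
  have hcomp : T.comp (-(X + C c)) =
      ∑ j ∈ Finset.range (n + 1), C (T.coeff j * (-1) ^ j) * (X + C c) ^ j := by
    rw [comp_eq_sum_left, sum_over_range' _ (by simp) (n + 1) (by omega)]
    refine Finset.sum_congr rfl fun j _ => ?_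
    rw [neg_pow, C_mul, C_pow, C_neg, C_1]; ring
  ext k
  rw [hcomp, finsetSum_coeff]
  simp only [coeff_C_mul, coeff_X_add_C_pow]
  by_cases hk : k ≤ n
  · rw [← h k hk]
    symm
    refine Finset.sum_subset_zero_on_sdiff (fun j hj => ?_) (fun j hj => ?_) (fun j _ => by ring)
    · simp only [Finset.mem_Icc, Finset.mem_range] at hj ⊢; omega
    · simp only [Finset.mem_sdiff, Finset.mem_range, Finset.mem_Icc] at hj
      rw [Nat.choose_eq_zero_of_lt (by omega)]; simp
  · rw [coeff_eq_zero_of_natDegree_lt (by omega)]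
    refine Finset.sum_eq_zero fun j hj => ?_
    rw [Finset.mem_range] at hj
    rw [Nat.choose_eq_zero_of_lt (by omega)]; simp

lemma X_pow_natTrailingDegree_dvd {R : Type*} [Semiring R] (f : R[X]) :
    X ^ f.natTrailingDegree ∣ f :=
  X_pow_dvd_iff.2 fun _ hd => coeff_eq_zero_of_lt_natTrailingDegree hd

/-- The reflection `z ↦ -(z + c)` moves the root `0` to `-c`, with the same multiplicity. -/
lemma two_mul_natTrailingDegree_le_natDegree {K : Type*} [Field K] {T : K[X]} (hT : T ≠ 0) {c : K}
    (hc : c ≠ 0) (h : T.comp (-(X + C c)) = T) : 2 * T.natTrailingDegree ≤ T.natDegree := by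
  set j := T.natTrailingDegree
  have hX : (X : K[X]) ^ j ∣ T := X_pow_natTrailingDegree_dvd T
  have hXc : (X + C c) ^ j ∣ T := by
    obtain ⟨g, hg⟩ := hX
    refine ⟨(-1) ^ j * g.comp (-(X + C c)), ?_⟩
    calc T = (X ^ j * g).comp (-(X + C c)) := by rw [← hg, h]
      _ = _ := by rw [mul_comp, X_pow_comp, neg_pow]; ring
  have hcop : IsCoprime (X : K[X]) (X + C c) := by
    have := isCoprime_X_sub_C_of_isUnit_sub (R := K) (a := 0) (b := -c) (by simpa using hc)
    simpa using this
  have hdeg := natDegree_le_of_dvd ((hcop.pow (m := j) (n := j)).mul_dvd hX hXc) hT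
  rw [natDegree_mul (pow_ne_zero _ X_ne_zero) (pow_ne_zero _ (X_add_C_ne_zero c)), natDegree_pow,
    natDegree_pow, natDegree_X, natDegree_X_add_C] at hdeg
  omega

/-- The numerator of `(f p) ^ (i) / p` over the denominator `A ^ i` if `p' / p = N / A`. -/
noncomputable def weightedDerivNum (A N f : ℝ[X]) : ℕ → ℝ[X]
  | 0 => f
  | i + 1 => A * derivative (weightedDerivNum A N f i) -
      C (i : ℝ) * derivative A * weightedDerivNum A N f i + N * weightedDerivNum A N f i

lemma iteratedDeriv_mul_eval_pow_eq {U : Set ℝ} (hU : IsOpen U) {p : ℝ → ℝ}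
    (hp : ContDiffOn ℝ ∞ p U) {A N : ℝ[X]}
    (hode : ∀ x ∈ U, A.eval x * deriv p x = N.eval x * p x) (f : ℝ[X]) (i : ℕ) :
    ∀ x ∈ U, iteratedDeriv i (fun z => f.eval z * p z) x * A.eval x ^ i =
      (weightedDerivNum A N f i).eval x * p x := by
  have hfp : ContDiffOn ℝ ∞ (fun z => f.eval z * p z) U :=
    (contDiff_polynomial_eval f).contDiffOn.mul hp
  set q := fun z => f.eval z * p z
  induction i with
  | zero => intro x _; simp [weightedDerivNum, q]
  | succ i ih =>
    intro x hx
    set F := weightedDerivNum A N f i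
    have hq := (((contDiffOn_iteratedDeriv hU hfp i).contDiffAt
      (hU.mem_nhds hx)).differentiableAt (by simp)).hasDerivAt
    have hp' := ((hp.contDiffAt (hU.mem_nhds hx)).differentiableAt (by simp)).hasDerivAt
    have hloc : (iteratedDeriv i q * (fun x => A.eval x) ^ i) =ᶠ[𝓝 x] ((fun x => F.eval x) * p) :=
      Filter.mem_of_superset (hU.mem_nhds hx) ih
    have hderiv := (hq.mul ((A.hasDerivAt x).pow i)).unique
      (((F.hasDerivAt x).mul hp').congr_of_eventuallyEq hloc)
    have hpow := natCast_mul_pow_sub_one_mul i (A.eval x)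
    simp only [weightedDerivNum, eval_add, eval_sub, eval_mul, eval_C, pow_succ]
    simp only [Pi.pow_apply, ← iteratedDeriv_succ] at hderiv
    linear_combination A.eval x * hderiv - iteratedDeriv i q x * (derivative A).eval x * hpow
      + F.eval x * hode x hx - i * (derivative A).eval x * ih x hx

lemma IsPlace.hasLeadingTerm_weightedDerivNum {l : Filter ℝ} {φ : ℝ → ℝ} {τ κ e e' : ℤ}
    (hP : IsPlace l φ τ) (hκ : τ < κ) {A N f : ℝ[X]} {α ν t : ℝ}
    (hA : HasLeadingTerm l φ e (A.eval ·) α) (hN : HasLeadingTerm l φ (e + κ) (N.eval ·) ν)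
    (hf : HasLeadingTerm l φ e' (f.eval ·) t) (i : ℕ) :
    HasLeadingTerm l φ (e' + i * (e + κ)) ((weightedDerivNum A N f i).eval ·) (t * ν ^ i) := by
  have hφ := hP.tendsto
  induction i with
  | zero => simpa [weightedDerivNum] using hf
  | succ i ih =>
    obtain ⟨c₁, hF'⟩ := hP.derivative _ _ _ ih
    obtain ⟨c₂, hA'⟩ := hP.derivative _ _ _ hA
    have horder : e + κ + (e' + i * (e + κ)) = e' + ((i + 1 : ℕ) : ℤ) * (e + κ) := by
      push_cast; ring
    have hAF' := (hA.mul hφ hF').of_lt hφ (e' := e' + ((i + 1 : ℕ) : ℤ) * (e + κ)) (by linarith)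
    have hA'F := ((hA'.mul hφ ih).const_mul (-i)).of_lt hφ
      (e' := e' + ((i + 1 : ℕ) : ℤ) * (e + κ)) (by linarith)
    have hNF := horder ▸ hN.mul hφ ih
    convert (hAF'.add hA'F).add hNF using 1
    · ext x
      simp only [weightedDerivNum, eval_add, eval_sub, eval_mul, eval_C]
      ring
    · ring

/-- The numerator of `p' / p` over the denominator `a n`, for a weight `p` that makes
`∑_{k=1}^n a_k(x) D^k` symmetric. -/
noncomputable def weightNum (n : ℕ) (a : ℕ → ℝ[X]) : ℝ[X] :=
  C (2 / (n : ℝ)) * a (n - 1) - derivative (a n)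

namespace IsFormallySymmetricOn

variable {n : ℕ} {a : ℕ → ℝ[X]} {p : ℝ → ℝ} {U : Set ℝ}

lemma even_order (hs : IsFormallySymmetricOn n a p U) (ha : a n ≠ 0) (hne : U.Nonempty) :
    Even n := by
  obtain ⟨x, hxU, hx⟩ : ∃ x ∈ U, (a n).eval x ≠ 0 := by
    by_contra! hroot
    obtain ⟨x, hx⟩ := hne
    exact ha (eq_zero_of_infinite_isRoot _
      ((infinite_of_mem_nhds x (hs.isOpen.mem_nhds hx)).mono hroot))
  have hk := hs.determining_eq x hxU n le_rfl
  simp only [Finset.Icc_self, Finset.sum_singleton, Nat.choose_self, Nat.cast_one, mul_one,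
    Nat.sub_self, iteratedDeriv_zero] at hk
  by_contra hodd
  rw [(Nat.not_even_iff_odd.1 hodd).neg_one_pow] at hk
  exact mul_ne_zero hx (hs.pos x hxU).ne' (by linarith)

lemma weight_ode (hs : IsFormallySymmetricOn n a p U) (hn : n ≠ 0) (ha : a n ≠ 0) :
    ∀ x ∈ U, (a n).eval x * deriv p x = (weightNum n a).eval x * p x := by
  intro x hx
  have heven := hs.even_order ha ⟨x, hx⟩
  obtain ⟨m, rfl⟩ := Nat.exists_eq_succ_of_ne_zero hn
  have hodd : Odd m := Nat.not_even_iff_odd.1 (Nat.even_add_one.1 heven)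
  have hk := hs.determining_eq x hx m m.le_succ
  have hderiv : deriv (fun z => (a (m + 1)).eval z * p z) x =
      (derivative (a (m + 1))).eval x * p x + (a (m + 1)).eval x * deriv p x :=
    (((a (m + 1)).hasDerivAt x).mul ((hs.contDiffOn.contDiffAt
      (hs.isOpen.mem_nhds hx)).differentiableAt (by simp)).hasDerivAt).deriv
  have hIcc : Finset.Icc m (m + 1) = {m, m + 1} := by
    ext j; simp only [Finset.mem_Icc, Finset.mem_insert, Finset.mem_singleton]; omega
  rw [Nat.succ_eq_add_one, hIcc, Finset.sum_pair (by omega)] at hk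
  simp only [Nat.choose_self, Nat.cast_one, mul_one, Nat.sub_self, iteratedDeriv_zero,
    hodd.neg_one_pow, heven.neg_one_pow, Nat.choose_succ_self_right, Nat.add_sub_cancel_left,
    iteratedDeriv_one, hderiv] at hk
  simp only [weightNum, eval_sub, eval_mul, eval_C, Nat.succ_eq_add_one, Nat.add_sub_cancel]
  have hm : ((m + 1 : ℕ) : ℝ) ≠ 0 := by exact_mod_cast hn
  field_simp
  linear_combination hk

section Place

variable {l : Filter ℝ} {φ : ℝ → ℝ} {τ κ e : ℤ} {α ν : ℝ}

lemma hasLeadingTerm_iteratedDeriv_div (hs : IsFormallySymmetricOn n a p U) (hn : n ≠ 0)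
    (ha : a n ≠ 0) (hP : IsPlace l φ τ) (hκ : τ < κ) (hl : U ∈ l) (hα : α ≠ 0)
    (hA : HasLeadingTerm l φ e ((a n).eval ·) α)
    (hN : HasLeadingTerm l φ (e + κ) ((weightNum n a).eval ·) ν)
    {f : ℝ[X]} {e' : ℤ} {t : ℝ} (hf : HasLeadingTerm l φ e' (f.eval ·) t) (i : ℕ) :
    HasLeadingTerm l φ (e' + i * κ) (fun x => iteratedDeriv i (fun z => f.eval z * p z) x / p x)
      (t * (ν / α) ^ i) := by
  have hquot := (hP.hasLeadingTerm_weightedDerivNum hκ hA hN hf i).div_pow hP.tendsto hA hα i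
  rw [mul_div_assoc, ← _root_.div_pow,
    show e' + i * (e + κ) - i * e = e' + i * κ by ring] at hquot
  refine Tendsto.congr' ?_ hquot
  filter_upwards [hl, Tendsto.eventually_ne hA hα] with x hxU hx
  have hnum := iteratedDeriv_mul_eval_pow_eq hs.isOpen hs.contDiffOn (hs.weight_ode hn ha) f i x hxU
  congr 1
  rw [div_eq_div_iff (pow_ne_zero i (left_ne_zero_of_mul hx)) (hs.pos x hxU).ne', hnum]

lemma symbol_recursion (hs : IsFormallySymmetricOn n a p U) (hn : n ≠ 0)
    (ha : a n ≠ 0) (hP : IsPlace l φ τ) (hκ : τ < κ) (hl : U ∈ l) (hα : α ≠ 0)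
    (hA : HasLeadingTerm l φ e ((a n).eval ·) α)
    (hN : HasLeadingTerm l φ (e + κ) ((weightNum n a).eval ·) ν) {M : ℤ} {t : ℕ → ℝ}
    (ht : ∀ k ≤ n, HasLeadingTerm l φ (M - k * κ) ((a k).eval ·) (t k)) {k : ℕ} (hk : k ≤ n) :
    ∑ j ∈ Finset.Icc k n, (-1) ^ j * (j.choose k : ℝ) * (t j * (ν / α) ^ (j - k)) = t k := by
  have hterm : ∀ j ∈ Finset.Icc k n, HasLeadingTerm l φ (M - k * κ)
      (fun x => (-1) ^ j * (j.choose k : ℝ) *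
        (iteratedDeriv (j - k) (fun z => (a j).eval z * p z) x / p x))
      ((-1) ^ j * (j.choose k : ℝ) * (t j * (ν / α) ^ (j - k))) := fun j hj => by
    rw [Finset.mem_Icc] at hj
    have hder := hs.hasLeadingTerm_iteratedDeriv_div hn ha hP hκ hl hα hA hN (ht j hj.2) (j - k)
    have horder : M - j * κ + (j - k : ℕ) * κ = M - k * κ := by
      push_cast [hj.1]; ring
    exact (horder ▸ hder).const_mul _
  have := hP.neBot
  refine tendsto_nhds_unique (HasLeadingTerm.sum hterm) ((ht k hk).congr' ?_)
  filter_upwards [hl] with x hx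
  rw [← mul_div_cancel_right₀ ((a k).eval x) (hs.pos x hx).ne',
    ← hs.determining_eq x hx k hk, Finset.sum_div]
  simp_rw [mul_div_assoc]

lemma two_mul_order_add_le (hs : IsFormallySymmetricOn n a p U) (hn : n ≠ 0)
    (hP : IsPlace l φ τ) (hκ : τ < κ) (hl : U ∈ l) (hα : α ≠ 0) (hν : ν ≠ 0)
    (hA : HasLeadingTerm l φ e ((a n).eval ·) α)
    (hN : HasLeadingTerm l φ (e + κ) ((weightNum n a).eval ·) ν) {β : ℤ} (hβ : 0 ≤ β + κ)
    (hbd : ∀ k ≤ n, ∃ c, HasLeadingTerm l φ (β * k) ((a k).eval ·) c) :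
    2 * (e + n * κ) ≤ n * (β + κ) := by
  have := hP.neBot
  have ha : a n ≠ 0 := by
    intro h
    simp only [h, eval_zero] at hA
    exact hα (tendsto_nhds_unique hA hasLeadingTerm_zero)
  obtain ⟨M, T, hT, hdeg, hlead⟩ := hP.exists_supporting_line ha κ
  have hreflect : T.comp (-(X + C (ν / α))) = T := comp_neg_X_add_C_eq_self hdeg fun k hk =>
    hs.symbol_recursion hn ha hP hκ hl hα hA hN hlead hk
  have htrail := two_mul_natTrailingDegree_le_natDegree hT (div_ne_zero hν hα) hreflect
  set j := T.natTrailingDegree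
  have hjn : j ≤ n := by omega
  obtain ⟨c, hc⟩ := hbd j hjn
  have hj : M - j * κ ≤ β * j :=
    (hlead j hjn).le hP.tendsto (trailingCoeff_nonzero_iff_nonzero.2 hT) hc
  have hM : e ≤ M - n * κ := hA.le hP.tendsto hα (hlead n le_rfl)
  have h2j : (2 * j : ℤ) ≤ n := by exact_mod_cast htrail.trans hdeg
  calc 2 * (e + n * κ) ≤ 2 * j * (β + κ) := by linarith
    _ ≤ n * (β + κ) := mul_le_mul_of_nonneg_right h2j hβ

end Place

end IsFormallySymmetricOn

lemma hasLeadingTerm_atTop (f : ℝ[X]) :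
    HasLeadingTerm atTop id f.natDegree (f.eval ·) f.leadingCoeff := by
  rcases eq_or_ne f 0 with rfl | hf
  · simpa using hasLeadingTerm_zero
  have h := div_tendsto_atTop_leadingCoeff_div_of_degree_eq f (X ^ f.natDegree)
    (by rw [degree_X_pow, degree_eq_natDegree hf])
  simp only [leadingCoeff_X_pow, div_one, eval_pow, eval_X] at h
  exact h.congr fun x => by rw [zpow_neg, zpow_natCast, id, div_eq_mul_inv]

lemma isPlace_atTop : IsPlace atTop id (-1) where
  neBot := atTop_neBot
  tendsto := tendsto_id
  exists_leadingTerm f hf := ⟨_, _, leadingCoeff_ne_zero.2 hf, hasLeadingTerm_atTop f⟩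
  derivative f e c h := by
    by_cases hf : f.natDegree = 0
    · rw [eq_C_of_natDegree_eq_zero hf]
      exact ⟨0, by simpa using hasLeadingTerm_zero⟩
    · have hf0 : f ≠ 0 := by rintro rfl; exact hf natDegree_zero
      have horder : (f.natDegree : ℤ) ≤ e :=
        (hasLeadingTerm_atTop f).le tendsto_id (leadingCoeff_ne_zero.2 hf0) h
      have hdeg := natDegree_derivative_le f
      exact (hasLeadingTerm_atTop f.derivative).mono tendsto_id (by omega)

lemma hasLeadingTerm_nhdsGT_zero {f : ℝ[X]} {m : ℕ} (h : X ^ m ∣ f) :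
    HasLeadingTerm (𝓝[>] 0) (fun x => x⁻¹) (-m) (f.eval ·) (f.coeff m) := by
  obtain ⟨g, rfl⟩ := h
  have hcoeff : (X ^ m * g).coeff m = g.eval 0 := by
    rw [← coeff_zero_eq_eval_zero]; simpa using coeff_X_pow_mul g m 0
  rw [hcoeff]
  refine (g.continuous.continuousAt.tendsto.mono_left nhdsWithin_le_nhds).congr' ?_
  filter_upwards [self_mem_nhdsWithin] with x (hx : 0 < x)
  rw [eval_mul, eval_pow, eval_X, neg_neg, zpow_natCast, inv_pow]
  field_simp

lemma isPlace_nhdsGT_zero : IsPlace (𝓝[>] 0) (fun x => x⁻¹) 1 where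
  neBot := inferInstance
  tendsto := tendsto_inv_nhdsGT_zero
  exists_leadingTerm f hf := ⟨_, _, trailingCoeff_nonzero_iff_nonzero.2 hf,
    hasLeadingTerm_nhdsGT_zero (X_pow_natTrailingDegree_dvd f)⟩
  derivative f e c h := by
    rcases eq_or_ne f 0 with rfl | hf
    · exact ⟨0, by simpa using hasLeadingTerm_zero⟩
    have hdvd := X_pow_natTrailingDegree_dvd f
    have horder : -(f.natTrailingDegree : ℤ) ≤ e := (hasLeadingTerm_nhdsGT_zero hdvd).le
      tendsto_inv_nhdsGT_zero (trailingCoeff_nonzero_iff_nonzero.2 hf) h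
    have hdvd' : X ^ (f.natTrailingDegree - 1) ∣ f.derivative :=
      pow_sub_one_dvd_derivative_of_pow_dvd hdvd
    exact (hasLeadingTerm_nhdsGT_zero hdvd').mono tendsto_inv_nhdsGT_zero (by omega)

/-- A differential operator `L = ∑_{k=1}^n a_k(x) D^k` with `deg a_k ≤ k` and `a_n ≠ 0`, together
with an admissible weight on `I` for which it is self-adjoint. As the sum starts at `k = 1`, the
unused coefficient `a 0` is normalised to be zero. -/
structure IsSelfAdjointSystem (n : ℕ) (a : ℕ → ℝ[X]) (I : Set ℝ) (p : ℝ → ℝ) : Prop where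
  order : IsPolyDiffOpOfOrder n a
  coeff_zero : a 0 = 0
  weight : IsAdmissibleWeight I p
  selfAdjoint : IsSelfAdjointFor n a I p

namespace IsSelfAdjointSystem

variable {n : ℕ} {a : ℕ → ℝ[X]} {I : Set ℝ} {p : ℝ → ℝ}

lemma leading_ne_zero (hS : IsSelfAdjointSystem n a I p) : a n ≠ 0 :=
  hS.order.leading_ne_zero

lemma order_ne_zero (hS : IsSelfAdjointSystem n a I p) : n ≠ 0 := by
  rintro rfl
  exact hS.leading_ne_zero hS.coeff_zero

lemma natDegree_le (hS : IsSelfAdjointSystem n a I p) {k : ℕ} (hk : k ≤ n) :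
    (a k).natDegree ≤ k := by
  rcases k.eq_zero_or_pos with rfl | hk0
  · simp [hS.coeff_zero]
  · exact hS.order.natDegree_le k (Finset.mem_Icc.2 ⟨hk0, hk⟩)

lemma exists_isFormallySymmetricOn_Ioi (hS : IsSelfAdjointSystem n a I p) {R₀ : ℝ}
    (hI : Set.Ioi R₀ ⊆ I) :
    ∃ R, 0 < R ∧ Set.Ioi R ⊆ I ∧ IsFormallySymmetricOn n a p (Set.Ioi R) := by
  obtain ⟨S, hS', hsm, hpos⟩ := hS.weight.piecewise_smooth_pos
  obtain ⟨B, hB⟩ := hS'.bddAbove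
  have hsub : Set.Ioi (max (max R₀ B) 1) ⊆ I \ S := fun x (hx : _ < x) => by
    simp only [max_lt_iff] at hx
    exact ⟨hI hx.1.1, fun h => absurd (hB h) (not_le.2 hx.1.2)⟩
  exact ⟨max (max R₀ B) 1, by simp, hsub.trans Set.sdiff_subset,
    hS.selfAdjoint.isFormallySymmetricOn hS.coeff_zero isOpen_Ioi (hsub.trans Set.sdiff_subset)
      (hsm.mono hsub) fun x hx => hpos x (hsub hx)⟩

end IsSelfAdjointSystem

lemma not_integrableOn_Ioi_of_monotoneOn {f : ℝ → ℝ} {R x₀ : ℝ} (hx₀ : R < x₀)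
    (hmono : MonotoneOn f (Set.Ioi R)) (hpos : 0 < f x₀) : ¬ IntegrableOn f (Set.Ioi R) := by
  intro hInt
  have hconst : IntegrableOn (fun _ : ℝ => f x₀) (Set.Ioi x₀) := by
    refine Integrable.mono' (hInt.mono_set (Set.Ioi_subset_Ioi hx₀.le))
      aestronglyMeasurable_const ?_
    filter_upwards [ae_restrict_mem measurableSet_Ioi] with x (hx : x₀ < x)
    rw [Real.norm_of_nonneg hpos.le]
    exact hmono hx₀ (hx₀.trans hx) hx.le
  rw [integrableOn_const_iff enorm_ne_top] at hconst
  rcases hconst with h | h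
  · exact hpos.ne' (enorm_eq_zero.1 h)
  · simp at h

lemma not_integrableOn_mul_pow_of_deriv_nonneg {p : ℝ → ℝ} {R : ℝ} (hR : 0 < R)
    (hd : DifferentiableOn ℝ p (Set.Ioi R)) (hpos : ∀ x ∈ Set.Ioi R, 0 < p x) (K : ℕ)
    (h : ∀ x ∈ Set.Ioi R, 0 ≤ K * p x + x * deriv p x) :
    ¬ IntegrableOn (fun x => p x * x ^ K) (Set.Ioi R) := by
  have hderiv : ∀ x ∈ Set.Ioi R, HasDerivAt (fun x => p x * x ^ K)
      (deriv p x * x ^ K + p x * (K * x ^ (K - 1))) x := fun x hx =>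
    ((hd.differentiableAt (Ioi_mem_nhds hx)).hasDerivAt).mul (hasDerivAt_pow K x)
  have hmono : MonotoneOn (fun x => p x * x ^ K) (Set.Ioi R) := by
    refine monotoneOn_of_hasDerivWithinAt_nonneg (convex_Ioi R)
      (fun x hx => (hderiv x hx).continuousAt.continuousWithinAt)
      (fun x hx => (hderiv x (interior_subset hx)).hasDerivWithinAt) fun x hx => ?_
    have hx := interior_subset hx
    have hx0 : 0 < x := hR.trans hx
    refine nonneg_of_mul_nonneg_left (le_of_le_of_eq
      (mul_nonneg (h x hx) (pow_nonneg hx0.le K)) ?_) hx0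
    linear_combination - p x * natCast_mul_pow_sub_one_mul K x
  exact not_integrableOn_Ioi_of_monotoneOn (lt_add_one R) hmono
    (mul_pos (hpos _ (lt_add_one R)) (pow_pos (by linarith) K))

namespace IsSelfAdjointSystem

variable {n : ℕ} {a : ℕ → ℝ[X]} {I : Set ℝ} {p : ℝ → ℝ} {R₀ : ℝ}

lemma not_eventually_weight_growth (hS : IsSelfAdjointSystem n a I p) (hI : Set.Ioi R₀ ⊆ I)
    (K : ℕ) : ¬ ∀ᶠ x in atTop, 0 ≤ K + x * ((weightNum n a).eval x / (a n).eval x) := by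
  intro hK
  obtain ⟨R, hR, hRI, hs⟩ := hS.exists_isFormallySymmetricOn_Ioi hI
  have hne : ∀ᶠ x in atTop, (a n).eval x ≠ 0 :=
    ((hasLeadingTerm_atTop (a n)).eventually_ne (leadingCoeff_ne_zero.2 hS.leading_ne_zero)).mono
      fun _ => left_ne_zero_of_mul
  obtain ⟨R₁, hR₁⟩ := eventually_atTop.1 (hK.and hne)
  have hsub : Set.Ioi (max R R₁) ⊆ Set.Ioi R := Set.Ioi_subset_Ioi (le_max_left _ _)
  refine not_integrableOn_mul_pow_of_deriv_nonneg (p := p) (lt_max_of_lt_left hR)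
    ((hs.contDiffOn.mono hsub).differentiableOn (by simp)) (fun x hx => hs.pos x (hsub hx)) K
    (fun x hx => ?_) (by simpa using (hS.weight.integrable (X ^ K)).mono_set (hsub.trans hRI))
  obtain ⟨hgrowth, hx0⟩ := hR₁ x ((le_max_right R R₁).trans (le_of_lt hx))
  have hode := hs.weight_ode hS.order_ne_zero hS.leading_ne_zero x (hsub hx)
  have hlog : deriv p x = (weightNum n a).eval x / (a n).eval x * p x := by
    field_simp; linarith
  rw [hlog, ← mul_assoc, ← add_mul]
  exact mul_nonneg hgrowth (hs.pos x (hsub hx)).le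

lemma degree_leading_le_degree_weightNum (hS : IsSelfAdjointSystem n a I p)
    (hI : Set.Ioi R₀ ⊆ I) : (a n).degree ≤ (weightNum n a).degree := by
  by_contra! hlt
  have hdeg : (X * weightNum n a).degree ≤ (a n).degree := by
    rw [degree_mul, degree_X, add_comm]
    exact Nat.WithBot.add_one_le_of_lt hlt
  obtain ⟨C, hC⟩ := (isBigO_atTop_of_degree_le _ _ hdeg).bound
  obtain ⟨K, hK⟩ := exists_nat_ge C
  refine hS.not_eventually_weight_growth hI K (hC.mono fun x hx => ?_)
  rw [eval_mul, eval_X] at hx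
  have hratio : |x * (weightNum n a).eval x / (a n).eval x| ≤ K := by
    rw [abs_div]
    refine div_le_of_le_mul₀ (abs_nonneg _) K.cast_nonneg (hx.trans ?_)
    exact mul_le_mul_of_nonneg_right hK (norm_nonneg _)
  rw [← mul_div_assoc]
  linarith [(abs_le.1 hratio).1]

lemma weightNum_ne_zero_of_unbounded (hS : IsSelfAdjointSystem n a I p)
    (hI : Set.Ioi R₀ ⊆ I) : weightNum n a ≠ 0 := fun h =>
  hS.leading_ne_zero (degree_eq_bot.1 (le_bot_iff.1
    (degree_zero (R := ℝ) ▸ h ▸ hS.degree_leading_le_degree_weightNum hI)))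

lemma two_mul_add_mul_natDegree_sub_le (hS : IsSelfAdjointSystem n a I p)
    (hI : Set.Ioi R₀ ⊆ I) {κ : ℕ} (hκ : (weightNum n a).natDegree = (a n).natDegree + κ) :
    2 * ((a n).natDegree + n * κ) ≤ n * (1 + κ) := by
  obtain ⟨R, -, -, hs⟩ := hS.exists_isFormallySymmetricOn_Ioi hI
  have hA0 := leadingCoeff_ne_zero.2 hS.leading_ne_zero
  have hN0 : (weightNum n a).leadingCoeff ≠ 0 :=
    leadingCoeff_ne_zero.2 (hS.weightNum_ne_zero_of_unbounded hI)
  have hN : HasLeadingTerm atTop id ((a n).natDegree + (κ : ℤ)) ((weightNum n a).eval ·)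
      (weightNum n a).leadingCoeff := by
    have := hasLeadingTerm_atTop (weightNum n a)
    rwa [hκ, Nat.cast_add] at this
  have hbd : ∀ k ≤ n, ∃ c, HasLeadingTerm atTop id (1 * k) ((a k).eval ·) c := fun k hk =>
    (hasLeadingTerm_atTop (a k)).mono tendsto_id (by have := hS.natDegree_le hk; omega)
  have key := hs.two_mul_order_add_le hS.order_ne_zero isPlace_atTop (by omega)
    (Ioi_mem_atTop R) hA0 hN0 (hasLeadingTerm_atTop (a n)) hN (by omega) hbd
  exact_mod_cast key

lemma two_mul_natDegree_leading_le (hS : IsSelfAdjointSystem n a I p) (hI : Set.Ioi R₀ ⊆ I) :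
    2 * (a n).natDegree ≤ n := by
  obtain ⟨κ, hκ⟩ := Nat.exists_eq_add_of_le
    (natDegree_le_natDegree (hS.degree_leading_le_degree_weightNum hI))
  have key := hS.two_mul_add_mul_natDegree_sub_le hI hκ
  nlinarith

lemma weightNum_leading_of_unbounded (hS : IsSelfAdjointSystem n a I p) (hI : Set.Ioi R₀ ⊆ I)
    (hdeg : (a n).natDegree ≠ 0) :
    (weightNum n a).natDegree = (a n).natDegree ∧
      (weightNum n a).leadingCoeff / (a n).leadingCoeff < 0 := by
  obtain ⟨κ, hκ⟩ := Nat.exists_eq_add_of_le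
    (natDegree_le_natDegree (hS.degree_leading_le_degree_weightNum hI))
  have key := hS.two_mul_add_mul_natDegree_sub_le hI hκ
  have hκ0 : κ = 0 := by
    by_contra hκ0
    have : n * 1 ≤ n * κ := Nat.mul_le_mul_left n (Nat.one_le_iff_ne_zero.2 hκ0)
    have : 0 < (a n).natDegree := Nat.pos_of_ne_zero hdeg
    nlinarith
  have hN := hS.weightNum_ne_zero_of_unbounded hI
  have hdegN : (weightNum n a).natDegree = (a n).natDegree := by rw [hκ, hκ0, add_zero]
  have hratio0 : (weightNum n a).leadingCoeff / (a n).leadingCoeff ≠ 0 :=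
    div_ne_zero (leadingCoeff_ne_zero.2 hN) (leadingCoeff_ne_zero.2 hS.leading_ne_zero)
  refine ⟨hdegN, hratio0.lt_of_le (not_lt.1 fun hratio => ?_)⟩
  have hlim := (weightNum n a).div_tendsto_atTop_leadingCoeff_div_of_degree_eq (a n)
    (by rw [degree_eq_natDegree hN, degree_eq_natDegree hS.leading_ne_zero, hdegN])
  refine hS.not_eventually_weight_growth hI 0 ?_
  filter_upwards [hlim.eventually_const_le hratio, eventually_ge_atTop 0] with x hx hx0
  simpa using mul_nonneg hx0 hx

end IsSelfAdjointSystem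

section Watson

variable {v w : ℝ → ℝ} {σ c t : ℝ}

lemma integrableOn_rpow_mul_exp_neg_mul (hσ : -1 < σ) (ht : 0 < t) :
    IntegrableOn (fun x => x ^ σ * Real.exp (-t * x)) (Set.Ioi 0) := by
  simpa using integrableOn_rpow_mul_exp_neg_mul_rpow (p := 1) hσ one_pos ht

lemma rpow_mul_integral_rpow_mul_exp (hσ : -1 < σ) (ht : 0 < t) :
    t ^ (σ + 1) * ∫ x in Set.Ioi 0, x ^ σ * Real.exp (-t * x) = Real.Gamma (σ + 1) := by
  have h := Real.integral_rpow_mul_exp_neg_mul_Ioi (a := σ + 1) (r := t) (by linarith) ht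
  simp only [add_sub_cancel_right, ← neg_mul] at h
  rw [h, ← mul_assoc, ← Real.mul_rpow ht.le (by positivity), mul_one_div_cancel ht.ne',
    Real.one_rpow, one_mul]

lemma integrableOn_mul_exp_neg_mul {I : Set ℝ} (hIm : MeasurableSet I) (hI : I ⊆ Set.Ici 0)
    (hw : IntegrableOn w I) (ht : 0 ≤ t) :
    IntegrableOn (fun x => w x * Real.exp (-t * x)) I := by
  refine Integrable.mono hw (hw.aestronglyMeasurable.mul (by fun_prop)) ?_
  filter_upwards [ae_restrict_mem hIm] with x hx
  have hx : 0 ≤ x := hI hx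
  rw [norm_mul, Real.norm_of_nonneg (Real.exp_pos _).le]
  exact mul_le_of_le_one_right (norm_nonneg _) (Real.exp_le_one_iff.2 (by nlinarith))

lemma rpow_mul_norm_integral_exp_le (hσ : -1 < σ)
    (hv : IntegrableOn (fun x => v x * Real.exp (-x)) (Set.Ioi 0)) {η δ : ℝ} (hη : 0 ≤ η)
    (hnear : ∀ x ∈ Set.Ioo 0 δ, |v x| ≤ η * x ^ σ) (ht : 1 < t) :
    t ^ (σ + 1) * ‖∫ x in Set.Ioi 0, v x * Real.exp (-t * x)‖ ≤ η * Real.Gamma (σ + 1) +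
      t ^ (σ + 1) * (Real.exp (-(t - 1) * δ) * ∫ x in Set.Ioi 0, |v x * Real.exp (-x)|) := by
  have ht0 : 0 < t := by linarith
  have hpow := (integrableOn_rpow_mul_exp_neg_mul hσ ht0).const_mul η
  have htail := hv.abs.const_mul (Real.exp (-(t - 1) * δ))
  have hbound : ∀ x ∈ Set.Ioi (0 : ℝ), ‖v x * Real.exp (-t * x)‖ ≤
      η * (x ^ σ * Real.exp (-t * x)) + Real.exp (-(t - 1) * δ) * |v x * Real.exp (-x)| := by
    intro x (hx : 0 < x)
    rw [norm_mul, Real.norm_of_nonneg (Real.exp_pos _).le, Real.norm_eq_abs]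
    rcases lt_or_ge x δ with hxδ | hxδ
    · refine le_add_of_le_of_nonneg ?_ (by positivity)
      rw [← mul_assoc]
      exact mul_le_mul_of_nonneg_right (hnear x ⟨hx, hxδ⟩) (Real.exp_pos _).le
    · refine le_add_of_nonneg_of_le (by positivity) ?_
      have hexp : Real.exp (-t * x) ≤ Real.exp (-(t - 1) * δ) * Real.exp (-x) := by
        rw [← Real.exp_add, Real.exp_le_exp]
        nlinarith
      rw [abs_mul, abs_of_pos (Real.exp_pos (-x)), mul_left_comm]
      exact mul_le_mul_of_nonneg_left hexp (abs_nonneg _)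
  have hint : ‖∫ x in Set.Ioi 0, v x * Real.exp (-t * x)‖ ≤
      η * (∫ x in Set.Ioi 0, x ^ σ * Real.exp (-t * x)) +
        Real.exp (-(t - 1) * δ) * ∫ x in Set.Ioi 0, |v x * Real.exp (-x)| := by
    rw [← integral_const_mul, ← integral_const_mul, ← integral_add hpow htail]
    exact norm_integral_le_of_norm_le (hpow.add htail)
      ((ae_restrict_mem measurableSet_Ioi).mono hbound)
  refine (mul_le_mul_of_nonneg_left hint (by positivity)).trans_eq ?_
  rw [← rpow_mul_integral_rpow_mul_exp hσ ht0]
  ring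

lemma tendsto_rpow_mul_exp_neg_sub_one_mul {δ : ℝ} (hδ : 0 < δ) (s K : ℝ) :
    Tendsto (fun t : ℝ => t ^ s * (Real.exp (-(t - 1) * δ) * K)) atTop (𝓝 0) := by
  have h := (tendsto_rpow_mul_exp_neg_mul_atTop_nhds_zero s δ hδ).mul_const (Real.exp δ * K)
  rw [zero_mul] at h
  refine h.congr fun t => ?_
  rw [show -(t - 1) * δ = -δ * t + δ by ring, Real.exp_add]
  ring

lemma tendsto_rpow_mul_laplace_of_isLittleO (hσ : -1 < σ)
    (hv : IntegrableOn (fun x => v x * Real.exp (-x)) (Set.Ioi 0))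
    (hv0 : v =o[𝓝[>] 0] fun x => x ^ σ) :
    Tendsto (fun t => t ^ (σ + 1) * ∫ x in Set.Ioi 0, v x * Real.exp (-t * x)) atTop (𝓝 0) := by
  have hΓ : 0 < Real.Gamma (σ + 1) := Real.Gamma_pos_of_pos (by linarith)
  rw [Metric.tendsto_nhds]
  intro ε hε
  have hη : 0 < ε / 2 / Real.Gamma (σ + 1) := by positivity
  obtain ⟨δ, hδ, hnear⟩ := mem_nhdsGT_iff_exists_Ioo_subset.1 (hv0.bound hη)
  filter_upwards [eventually_gt_atTop 1,
    (tendsto_rpow_mul_exp_neg_sub_one_mul hδ (σ + 1)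
      (∫ x in Set.Ioi 0, |v x * Real.exp (-x)|)).eventually_lt_const (half_pos hε)]
    with t ht hsmall
  have hle := rpow_mul_norm_integral_exp_le hσ hv hη.le (fun x hx => by
    have h : ‖v x‖ ≤ _ * ‖x ^ σ‖ := hnear hx
    rwa [Real.norm_of_nonneg (Real.rpow_nonneg hx.1.le σ)] at h) ht
  rw [div_mul_cancel₀ _ hΓ.ne'] at hle
  rw [dist_zero_right, norm_mul, Real.norm_of_nonneg (by positivity)]
  linarith

/-- The leading term of Watson's lemma. -/
lemma tendsto_rpow_mul_laplace (hσ : -1 < σ) (hw : IntegrableOn w (Set.Ioi 0))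
    (hw0 : Tendsto (fun x => w x * x ^ (-σ)) (𝓝[>] 0) (𝓝 c)) :
    Tendsto (fun t => t ^ (σ + 1) * ∫ x in Set.Ioi 0, w x * Real.exp (-t * x)) atTop
      (𝓝 (c * Real.Gamma (σ + 1))) := by
  have hwexp : ∀ {t : ℝ}, 0 < t → IntegrableOn (fun x => w x * Real.exp (-t * x)) (Set.Ioi 0) :=
    fun ht => integrableOn_mul_exp_neg_mul measurableSet_Ioi Set.Ioi_subset_Ici_self hw ht.le
  have hpow : ∀ {t : ℝ}, 0 < t →
      IntegrableOn (fun x => c * (x ^ σ * Real.exp (-t * x))) (Set.Ioi 0) :=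
    fun ht => (integrableOn_rpow_mul_exp_neg_mul hσ ht).const_mul c
  have hv : IntegrableOn (fun x => (w x - c * x ^ σ) * Real.exp (-x)) (Set.Ioi 0) := by
    refine ((hwexp one_pos).sub (hpow one_pos)).congr (.of_forall fun x => ?_)
    simp only [Pi.sub_apply, neg_mul, one_mul]; ring
  have hv0 : (fun x => w x - c * x ^ σ) =o[𝓝[>] 0] fun x => x ^ σ := by
    have hpos : ∀ᶠ x : ℝ in 𝓝[>] 0, 0 < x ^ σ :=
      eventually_mem_nhdsWithin.mono fun x hx => Real.rpow_pos_of_pos hx σ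
    rw [Asymptotics.isLittleO_iff_tendsto' (hpos.mono fun x hx h => absurd h hx.ne')]
    have h := hw0.sub_const c
    rw [sub_self] at h
    refine h.congr' ?_
    filter_upwards [self_mem_nhdsWithin, hpos] with x hx hxσ
    rw [Real.rpow_neg (le_of_lt hx)]
    field_simp
  have h := (tendsto_rpow_mul_laplace_of_isLittleO hσ hv hv0).add_const (c * Real.Gamma (σ + 1))
  rw [zero_add] at h
  refine h.congr' ?_
  filter_upwards [eventually_gt_atTop 0] with t ht
  simp_rw [sub_mul, mul_assoc]
  rw [integral_sub (hwexp ht) (hpow ht), integral_const_mul,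
    ← rpow_mul_integral_rpow_mul_exp hσ ht]
  ring

end Watson

/-- A smooth function of temperate growth equal to `exp (-t x)` for `x ≥ 0`. -/
noncomputable def expCutoff (t x : ℝ) : ℝ := Real.smoothTransition (x + 1) * Real.exp (-t * x)

namespace expCutoff

variable {t x : ℝ}

lemma eq_exp (hx : 0 ≤ x) : expCutoff t x = Real.exp (-t * x) := by
  rw [expCutoff, Real.smoothTransition.one_of_one_le (by linarith), one_mul]

lemma iteratedDeriv_of_pos (hx : 0 < x) (k : ℕ) :
    iteratedDeriv k (expCutoff t) x = (-t) ^ k * Real.exp (-t * x) := by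
  have h : expCutoff t =ᶠ[𝓝 x] fun x => Real.exp (-t * x) :=
    mem_of_superset (Ioi_mem_nhds hx) fun z hz => eq_exp (le_of_lt hz)
  rw [h.iteratedDeriv_eq, iteratedDeriv_exp_const_mul]

lemma iteratedDeriv_of_lt (hx : x < -1) (k : ℕ) : iteratedDeriv k (expCutoff t) x = 0 := by
  have h : expCutoff t =ᶠ[𝓝 x] fun _ => 0 := by
    filter_upwards [Iio_mem_nhds hx] with z (hz : z < -1)
    rw [expCutoff, Real.smoothTransition.zero_of_nonpos (by linarith), zero_mul]
  rw [h.iteratedDeriv_eq]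
  simp

lemma contDiff : ContDiff ℝ ∞ (expCutoff t) :=
  (Real.smoothTransition.contDiff.comp (contDiff_id.add contDiff_const)).mul (by fun_prop)

lemma hasTemperateGrowth (ht : 0 ≤ t) : Function.HasTemperateGrowth (expCutoff t) := by
  refine ⟨contDiff, fun k => ⟨0, ?_⟩⟩
  obtain ⟨K, hK⟩ := (isCompact_Icc (a := (-1 : ℝ)) (b := 0)).exists_bound_of_continuousOn
    (contDiff.continuous_iteratedDeriv k (by exact_mod_cast le_top)).continuousOn
  refine ⟨max K (t ^ k), fun x => ?_⟩
  rw [norm_iteratedFDeriv_eq_norm_iteratedDeriv, pow_zero, mul_one]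
  rcases lt_or_ge 0 x with hx | hx
  · rw [iteratedDeriv_of_pos hx, norm_mul, norm_pow, norm_neg, Real.norm_of_nonneg ht,
      Real.norm_of_nonneg (Real.exp_pos _).le]
    exact le_max_of_le_right (mul_le_of_le_one_right (by positivity)
      (Real.exp_le_one_iff.2 (by nlinarith)))
  rcases le_or_gt (-1) x with hx' | hx'
  · exact le_max_of_le_left (hK x ⟨hx', hx⟩)
  · rw [iteratedDeriv_of_lt hx', norm_zero]
    exact le_max_of_le_right (by positivity)

end expCutoff

/-- The Laplace transform of `p f` over `I`, at `t`. -/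
noncomputable def weightedLaplace (I : Set ℝ) (p : ℝ → ℝ) (f : ℝ[X]) (t : ℝ) : ℝ :=
  ∫ x in I, p x * f.eval x * Real.exp (-t * x)

/-- The set `I` has the lower endpoint `0`, where the function `p` on `I` is asymptotic to
`c x^s` with `c > 0` and `s > -1`. -/
structure HasPowerEndpoint (I : Set ℝ) (p : ℝ → ℝ) (s c : ℝ) : Prop where
  measurableSet : MeasurableSet I
  subset_Ici : I ⊆ Set.Ici 0
  mem_nhdsGT : I ∈ 𝓝[>] 0
  neg_one_lt : -1 < s
  pos : 0 < c
  tendsto : Tendsto (fun x => p x * x ^ (-s)) (𝓝[>] 0) (𝓝 c)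

section Laplace

variable {n : ℕ} {a : ℕ → ℝ[X]} {I : Set ℝ} {p : ℝ → ℝ} {s c : ℝ}

lemma IsSelfAdjointSystem.sum_weightedLaplace (hS : IsSelfAdjointSystem n a I p)
    (hIm : MeasurableSet I) (hI : I ⊆ Set.Ici 0) {t : ℝ} (ht : 0 ≤ t) (u : ℝ[X]) :
    ∑ k ∈ Finset.Icc 1 n, (-t) ^ k * weightedLaplace I p (a k * u) t =
      weightedLaplace I p (∑ k ∈ Finset.Icc 1 n, a k * derivative^[k] u) t := by
  have hpos : ∀ᵐ x ∂volume.restrict I, 0 < x := by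
    filter_upwards [ae_restrict_mem hIm, ae_restrict_of_ae (Measure.ae_ne volume 0)] with x hx hx0
    exact lt_of_le_of_ne (hI hx) hx0.symm
  have hint : ∀ k, IntegrableOn (fun x => p x * (a k * u).eval x * Real.exp (-t * x)) I := fun k =>
    integrableOn_mul_exp_neg_mul hIm hI (hS.weight.integrable (a k * u)) ht
  calc _ = weightedInner I p (polyDiffOp n a (expCutoff t)) (u.eval ·) := by
        simp only [weightedLaplace, ← integral_const_mul]
        rw [← integral_finsetSum _ fun k _ => (hint k).const_mul _]
        refine integral_congr_ae (hpos.mono fun x hx => ?_)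
        simp only [polyDiffOp, expCutoff.iteratedDeriv_of_pos hx, eval_mul, Finset.mul_sum,
          Finset.sum_mul]
        exact Finset.sum_congr rfl fun k _ => by ring
    _ = weightedInner I p (expCutoff t) (polyDiffOp n a (u.eval ·)) :=
        hS.selfAdjoint _ _ (expCutoff.hasTemperateGrowth ht) (hasTemperateGrowth_polynomial_eval u)
    _ = _ := by
        refine integral_congr_ae (hpos.mono fun x hx => ?_)
        simp only [polyDiffOp, iteratedDeriv_polynomial_eval, expCutoff.eq_exp hx.le,
          eval_finsetSum, eval_mul]
        ring

namespace HasPowerEndpoint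

lemma tendsto_weightedLaplace (hE : HasPowerEndpoint I p s c) (hp : IsAdmissibleWeight I p)
    {f : ℝ[X]} {e : ℕ} (hf : X ^ e ∣ f) :
    Tendsto (fun t => t ^ (s + e + 1) * weightedLaplace I p f t) atTop
      (𝓝 (c * f.coeff e * Real.Gamma (s + e + 1))) := by
  have hw : IntegrableOn (I.indicator fun x => p x * f.eval x) (Set.Ioi 0) :=
    ((integrable_indicator_iff hE.measurableSet).2 (hp.integrable f)).integrableOn
  have hw0 : Tendsto (fun x => (I.indicator fun x => p x * f.eval x) x * x ^ (-(s + e))) (𝓝[>] 0)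
      (𝓝 (c * f.coeff e)) := by
    refine (hE.tendsto.mul (hasLeadingTerm_nhdsGT_zero hf)).congr' ?_
    filter_upwards [hE.mem_nhdsGT, self_mem_nhdsWithin] with x hxI (hx : 0 < x)
    rw [Set.indicator_of_mem hxI, neg_add, Real.rpow_add hx, Real.rpow_neg hx.le (e : ℝ),
      Real.rpow_natCast, neg_neg, zpow_natCast, inv_pow]
    ring
  have hσ : -1 < s + e := hE.neg_one_lt.trans_le (le_add_of_nonneg_right e.cast_nonneg)
  refine (tendsto_rpow_mul_laplace hσ hw hw0).congr fun t => ?_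
  have hindicator : ∀ x, I.indicator (fun x => p x * f.eval x) x * Real.exp (-t * x) =
      I.indicator (fun x => p x * f.eval x * Real.exp (-t * x)) x := fun x => by
    by_cases hx : x ∈ I <;> simp [hx]
  simp_rw [hindicator]
  rw [← integral_Ici_eq_integral_Ioi, setIntegral_indicator hE.measurableSet,
    Set.inter_eq_right.2 hE.subset_Ici, weightedLaplace]

lemma tendsto_weightedLaplace_of_lt (hE : HasPowerEndpoint I p s c) (hp : IsAdmissibleWeight I p)
    {f : ℝ[X]} {e : ℕ} (hf : X ^ e ∣ f) {r : ℝ} (hr : r < s + e + 1) :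
    Tendsto (fun t => t ^ r * weightedLaplace I p f t) atTop (𝓝 0) := by
  have h := (tendsto_rpow_neg_atTop (sub_pos.2 hr)).mul (hE.tendsto_weightedLaplace hp hf)
  rw [zero_mul] at h
  refine h.congr' ?_
  filter_upwards [eventually_gt_atTop 0] with t ht
  rw [← mul_assoc, ← Real.rpow_add ht, neg_sub, sub_add_cancel]

lemma tendsto_mul_weightedLaplace_coeff (hE : HasPowerEndpoint I p s c)
    (hp : IsAdmissibleWeight I p) {f : ℝ[X]} {d k : ℕ} (hf : X ^ (k - d) ∣ f) (j : ℕ) :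
    Tendsto (fun t : ℝ => t ^ (s + j + 1 - d) * ((-t) ^ k * weightedLaplace I p (f * X ^ j) t))
      atTop (𝓝 (if d ≤ k then
        c * ((-1) ^ k * f.coeff (k - d) * Real.Gamma (s + 1 + j + (k - d : ℕ))) else 0)) := by
  have hpow : ∀ᶠ t : ℝ in atTop, (-1) ^ k * (t ^ (s + j + 1 - d + k) *
      weightedLaplace I p (f * X ^ j) t) =
      t ^ (s + j + 1 - d) * ((-t) ^ k * weightedLaplace I p (f * X ^ j) t) := by
    filter_upwards [eventually_gt_atTop 0] with t ht
    rw [Real.rpow_add ht, Real.rpow_natCast, neg_pow t k]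
    ring
  refine Tendsto.congr' hpow ?_
  split_ifs with hdk
  · have hdvd : X ^ (k - d + j) ∣ f * X ^ j := by
      rw [pow_add]; exact mul_dvd_mul_right hf _
    have h := (hE.tendsto_weightedLaplace hp hdvd).const_mul ((-1) ^ k)
    rw [coeff_mul_X_pow] at h
    have hexp : s + (k - d + j : ℕ) + 1 = s + j + 1 - d + k := by push_cast [hdk]; ring
    have hΓ : s + 1 + j + (k - d : ℕ) = s + j + 1 - d + k := by push_cast [hdk]; ring
    rw [hexp] at h
    rw [hΓ]
    convert h using 2
    ring
  · have hlt : s + j + 1 - d + k < s + j + 1 := by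
      have : (k : ℝ) < d := by exact_mod_cast not_le.1 hdk
      linarith
    simpa using (hE.tendsto_weightedLaplace_of_lt hp (Dvd.intro_left f rfl) hlt).const_mul
      ((-1) ^ k)

/-- Compare the coefficients of the leading power of `t` on both sides of
`IsSelfAdjointSystem.sum_weightedLaplace`. -/
lemma sum_coeff_mul_Gamma_eq_zero (hE : HasPowerEndpoint I p s c)
    (hS : IsSelfAdjointSystem n a I p) {d j : ℕ} (hj : j < d) (hd : ∀ k ≤ n, X ^ (k - d) ∣ a k) :
    ∑ i ∈ Finset.range (n + 1 - d), (-1) ^ (d + i) * (a (d + i)).coeff i *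
      Real.Gamma (s + 1 + j + i) = 0 := by
  have hrhs : Tendsto (fun t : ℝ => t ^ (s + j + 1 - d) *
      weightedLaplace I p (∑ k ∈ Finset.Icc 1 n, a k * derivative^[k] (X ^ j)) t) atTop (𝓝 0) := by
    refine hE.tendsto_weightedLaplace_of_lt hS.weight (e := 0) (by simp) ?_
    have : (j : ℝ) < d := by exact_mod_cast hj
    push_cast
    linarith
  have hlhs := tendsto_finsetSum (Finset.Icc 1 n) fun k hk =>
    hE.tendsto_mul_weightedLaplace_coeff hS.weight (hd k (Finset.mem_Icc.1 hk).2) j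
  have hsum := tendsto_nhds_unique hlhs (hrhs.congr' <| by
    filter_upwards [eventually_ge_atTop 0] with t ht
    rw [← Finset.mul_sum, hS.sum_weightedLaplace hE.measurableSet hE.subset_Ici ht])
  have hIco : (Finset.Icc 1 n).filter (d ≤ ·) = Finset.Ico d (n + 1) := by
    ext k
    simp only [Finset.mem_filter, Finset.mem_Icc, Finset.mem_Ico]
    omega
  rw [← Finset.sum_filter, hIco, Finset.sum_Ico_eq_sum_range, ← Finset.mul_sum] at hsum
  simpa [hE.pos.ne'] using hsum

end HasPowerEndpoint

end Laplace

lemma Gamma_add_natCast {z : ℝ} (hz : 0 < z) (i : ℕ) :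
    Real.Gamma (z + i) = (ascPochhammer ℝ i).eval z * Real.Gamma z := by
  induction i with
  | zero => simp
  | succ i ih =>
    rw [ascPochhammer_succ_eval, Nat.cast_succ, ← add_assoc, Real.Gamma_add_one (by positivity), ih]
    ring

/-- The rising factorials, as a sequence of polynomials with one member of each degree. -/
noncomputable def ascPochhammerSequence : Polynomial.Sequence ℝ where
  elems' := ascPochhammer ℝ
  degree_eq' i := by
    rw [degree_eq_natDegree (monic_ascPochhammer ℝ i).ne_zero, ascPochhammer_natDegree]

/-- Divided by `Γ(z + j)`, the `j`-th relation says that `z + j` is a root of the polynomial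
`∑ c i • ascPochhammer ℝ i`, which has degree less than `m`. -/
lemma eq_zero_of_sum_mul_Gamma_eq_zero {m : ℕ} {c : ℕ → ℝ} {z : ℝ} (hz : 0 < z)
    (h : ∀ j < m, ∑ i ∈ Finset.range m, c i * Real.Gamma (z + j + i) = 0) :
    ∀ i < m, c i = 0 := by
  set g : ℝ[X] := ∑ i ∈ Finset.range m, c i • ascPochhammer ℝ i with hg
  have hroot : ∀ j < m, g.eval (z + j) = 0 := fun j hj => by
    have hzj : 0 < z + j := by positivity
    have hsum := h j hj
    simp_rw [Gamma_add_natCast hzj, ← mul_assoc, ← Finset.sum_mul] at hsum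
    simpa [hg, eval_finsetSum] using
      (mul_eq_zero.1 hsum).resolve_right (Real.Gamma_pos_of_pos hzj).ne'
  have hdeg : g.degree < m := by
    refine (degree_sum_le _ _).trans_lt
      ((Finset.sup_lt_iff (WithBot.bot_lt_coe m)).2 fun i hi => ?_)
    refine (degree_smul_le _ _).trans_lt ?_
    rw [← show ascPochhammerSequence i = ascPochhammer ℝ i from rfl,
      ascPochhammerSequence.degree_eq]
    exact Nat.cast_lt.2 (Finset.mem_range.1 hi)
  have hg0 : g = 0 := eq_zero_of_degree_lt_of_eval_index_eq_zero (s := Finset.range m)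
    (v := fun j : ℕ => z + j) (fun i _ j _ hij => by simpa using hij) (by simpa using hdeg)
    fun j hj => hroot j (Finset.mem_range.1 hj)
  intro i hi
  exact linearIndependent_iff'.1 ascPochhammerSequence.linearIndependent (Finset.range m) c hg0 i
    (Finset.mem_range.2 hi)

lemma exists_tendsto_nhdsGT_of_isBoundedUnder_deriv {F F' : ℝ → ℝ} {b : ℝ}
    (hF : ∀ᶠ x in 𝓝[>] b, HasDerivAt F (F' x) x)
    (hF' : IsBoundedUnder (· ≤ ·) (𝓝[>] b) fun x => ‖F' x‖₊) :
    ∃ L, Tendsto F (𝓝[>] b) (𝓝 L) := by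
  obtain ⟨K, hK⟩ := hF'
  obtain ⟨d, hd, hsub⟩ := mem_nhdsGT_iff_exists_Ioo_subset.1 (hF.and (eventually_map.1 hK))
  have hLip : LipschitzOnWith K F (Set.Ioo b d) :=
    (convex_Ioo b d).lipschitzOnWith_of_nnnorm_hasDerivWithin_le
      (fun x hx => (hsub hx).1.hasDerivWithinAt) fun x hx => (hsub hx).2
  obtain ⟨g, hg, hgF⟩ := hLip.extend_real
  refine ⟨g b, (hg.continuous.continuousAt.tendsto.mono_left nhdsWithin_le_nhds).congr' ?_⟩
  exact mem_of_superset (Ioo_mem_nhdsGT hd) fun x hx => (hgF hx).symm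

section RegularSingularPoint

variable {A N : ℝ[X]} {m : ℕ}

lemma exists_eval_div_eq_div_add (hA : X ^ m ∣ A) (hAm : A.coeff m ≠ 0) (hN : X ^ m ∣ X * N) :
    ∃ h : ℝ → ℝ, ContinuousAt h 0 ∧ ∀ᶠ x in 𝓝[>] (0 : ℝ),
      N.eval x / A.eval x = (X * N).coeff m / A.coeff m / x + h x := by
  obtain ⟨A₁, rfl⟩ := hA
  obtain ⟨B, hB⟩ := hN
  have hcoeff : ∀ f : ℝ[X], (X ^ m * f).coeff m = f.eval 0 := fun f => by
    rw [← coeff_zero_eq_eval_zero]; simpa using coeff_X_pow_mul f m 0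
  rw [hB, hcoeff, hcoeff]
  rw [hcoeff] at hAm
  obtain ⟨G, hG⟩ : X ∣ B - C (B.eval 0 / A₁.eval 0) * A₁ := by
    rw [X_dvd_iff, coeff_zero_eq_eval_zero, eval_sub, eval_mul, eval_C, div_mul_cancel₀ _ hAm,
      sub_self]
  refine ⟨fun x => G.eval x / A₁.eval x,
    G.continuous.continuousAt.div A₁.continuous.continuousAt hAm, ?_⟩
  filter_upwards [self_mem_nhdsWithin,
    nhdsWithin_le_nhds (A₁.continuous.continuousAt.eventually_ne hAm)] with x (hx : 0 < x) hA₁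
  have hBx := congrArg (eval x) hB
  have hGx := congrArg (eval x) hG
  simp only [eval_mul, eval_pow, eval_X, eval_sub, eval_C] at hBx hGx ⊢
  generalize B.eval 0 / A₁.eval 0 = q at hGx ⊢
  field_simp
  linear_combination hBx + x ^ m * hGx

lemma exists_tendsto_mul_rpow {p : ℝ → ℝ} (hd : ∀ᶠ x in 𝓝[>] 0, DifferentiableAt ℝ p x)
    (hpos : ∀ᶠ x in 𝓝[>] 0, 0 < p x)
    (hode : ∀ᶠ x in 𝓝[>] 0, A.eval x * deriv p x = N.eval x * p x) (hA : X ^ m ∣ A)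
    (hAm : A.coeff m ≠ 0) (hN : X ^ m ∣ X * N) :
    ∃ c > 0, Tendsto (fun x => p x * x ^ (-((X * N).coeff m / A.coeff m))) (𝓝[>] 0) (𝓝 c) := by
  obtain ⟨h, hcont, hh⟩ := exists_eval_div_eq_div_add hA hAm hN
  set s := (X * N).coeff m / A.coeff m
  have hA0 : ∀ᶠ x in 𝓝[>] 0, A.eval x ≠ 0 :=
    ((hasLeadingTerm_nhdsGT_zero hA).eventually_ne hAm).mono fun _ => left_ne_zero_of_mul
  have hderiv : ∀ᶠ x in 𝓝[>] 0,
      HasDerivAt (fun x => Real.log (p x) - s * Real.log x) (h x) x := by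
    filter_upwards [hd, hpos, hode, hh, hA0, self_mem_nhdsWithin]
      with x hdx hpx hodex hhx hAx (hx : 0 < x)
    refine ((hdx.hasDerivAt.log hpx.ne').sub
      ((Real.hasDerivAt_log hx.ne').const_mul s)).congr_deriv ?_
    have hlog : deriv p x / p x = N.eval x / A.eval x := by
      rw [div_eq_div_iff hpx.ne' hAx]; linarith
    rw [hlog, hhx]
    ring
  obtain ⟨L, hL⟩ := exists_tendsto_nhdsGT_of_isBoundedUnder_deriv hderiv
    (hcont.tendsto.mono_left nhdsWithin_le_nhds).nnnorm.isBoundedUnder_le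
  refine ⟨Real.exp L, Real.exp_pos L, ((Real.continuous_exp.tendsto L).comp hL).congr' ?_⟩
  filter_upwards [hpos, self_mem_nhdsWithin] with x hpx (hx : 0 < x)
  rw [Function.comp_apply, Real.exp_sub, Real.exp_log hpx, Real.rpow_neg hx.le,
    Real.rpow_def_of_pos hx, mul_comm s, div_eq_mul_inv]

end RegularSingularPoint

lemma neg_one_lt_of_integrableOn {p : ℝ → ℝ} {I : Set ℝ} {s c : ℝ} (hI : I ∈ 𝓝[>] 0) (hc : 0 < c)
    (hInt : IntegrableOn p I)
    (hp : Tendsto (fun x => p x * x ^ (-s)) (𝓝[>] 0) (𝓝 c)) : -1 < s := by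
  obtain ⟨δ, hδ, hsub⟩ := mem_nhdsGT_iff_exists_Ioo_subset.1
    ((hp.eventually_const_lt (half_lt_self hc)).and hI)
  refine (intervalIntegral.integrableOn_Ioo_rpow_iff hδ).1 ?_
  refine Integrable.mono' ((hInt.mono_set fun x hx => (hsub hx).2).const_mul (2 / c))
    ((continuousOn_id.rpow_const fun x hx => Or.inl hx.1.ne').aestronglyMeasurable
      measurableSet_Ioo) ?_
  filter_upwards [ae_restrict_mem measurableSet_Ioo] with x hx
  have hxs := Real.rpow_pos_of_pos hx.1 s
  have hlow : c / 2 < p x * x ^ (-s) := (hsub hx).1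
  rw [Real.rpow_neg hx.1.le, ← div_eq_mul_inv, lt_div_iff₀ hxs] at hlow
  rw [Real.norm_of_nonneg hxs.le]
  calc x ^ s = 2 / c * (c / 2 * x ^ s) := by field_simp
    _ ≤ 2 / c * p x := mul_le_mul_of_nonneg_left hlow.le (by positivity)

lemma rootMultiplicity_zero_eq {R : Type*} [CommRing R] {f : R[X]} {k : ℕ}
    (h : ∀ i < k, f.coeff i = 0) (hk : f.coeff k ≠ 0) : f.rootMultiplicity 0 = k := by
  rw [rootMultiplicity_eq_natTrailingDegree']
  refine le_antisymm (natTrailingDegree_le_of_ne_zero hk) (le_natTrailingDegree ?_ h)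
  rintro rfl
  exact hk (coeff_zero k)

/-- The multiplicities that self-adjointness forces at a finite endpoint `r` of the interval. The
alternative distinguishes a regular from an irregular singular point of the equation for the
weight. -/
def HasEndpointMultiplicities (n : ℕ) (a : ℕ → ℝ[X]) (r : ℝ) : Prop :=
  n ≤ 2 * (a n).rootMultiplicity r ∧
    ((a (n - 1)).rootMultiplicity r + 1 = (a n).rootMultiplicity r ∨
      (a n).rootMultiplicity r = n ∧ (a (n - 1)).rootMultiplicity r + 2 = n)

lemma coeff_pred_eq {n : ℕ} (hn : n ≠ 0) (a : ℕ → ℝ[X]) (i : ℕ) :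
    (a (n - 1)).coeff i = n / 2 * ((weightNum n a).coeff i + (a n).coeff (i + 1) * (i + 1)) := by
  have : (n : ℝ) ≠ 0 := Nat.cast_ne_zero.2 hn
  rw [weightNum, coeff_sub, coeff_C_mul, coeff_derivative]
  field_simp
  ring

section Endpoint

variable {n : ℕ} {a : ℕ → ℝ[X]} {I : Set ℝ} {p : ℝ → ℝ}

lemma IsSelfAdjointSystem.exists_isFormallySymmetricOn_Ioo (hS : IsSelfAdjointSystem n a I p)
    (hI : I ∈ 𝓝[>] 0) :
    ∃ δ, 0 < δ ∧ IsFormallySymmetricOn n a p (Set.Ioo 0 δ) := by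
  obtain ⟨S, hfin, hsm, hpos⟩ := hS.weight.piecewise_smooth_pos
  have hS0 : (S \ {0})ᶜ ∈ 𝓝 (0 : ℝ) :=
    (hfin.subset Set.sdiff_subset).isClosed.isOpen_compl.mem_nhds (by simp)
  have hev : ∀ᶠ x in 𝓝[>] (0 : ℝ), x ∈ I \ S := by
    filter_upwards [hI, nhdsWithin_le_nhds hS0, self_mem_nhdsWithin] with x hxI hxS (hx : 0 < x)
    exact ⟨hxI, fun h => hxS ⟨h, hx.ne'⟩⟩
  obtain ⟨δ, hδ, hsub⟩ := mem_nhdsGT_iff_exists_Ioo_subset.1 hev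
  have hδI : Set.Ioo 0 δ ⊆ I := hsub.trans Set.sdiff_subset
  exact ⟨δ, hδ, hS.selfAdjoint.isFormallySymmetricOn hS.coeff_zero isOpen_Ioo hδI
    (hsm.mono hsub) fun x hx => hpos x (hsub hx)⟩

/-- The `d` relations of `sum_coeff_mul_Gamma_eq_zero` between `n + 1 - d` unknowns can have a
nonzero solution only if `2 d ≤ n`. -/
lemma HasPowerEndpoint.two_mul_le {s c : ℝ} (hE : HasPowerEndpoint I p s c)
    (hS : IsSelfAdjointSystem n a I p) {d i : ℕ} (hd : ∀ k ≤ n, X ^ (k - d) ∣ a k)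
    (hi : d + i ≤ n) (hcoeff : (a (d + i)).coeff i ≠ 0) : 2 * d ≤ n := by
  by_contra! hlt
  have hz : 0 < s + 1 := by linarith [hE.neg_one_lt]
  refine mul_ne_zero (pow_ne_zero (d + i) (neg_ne_zero.2 one_ne_zero)) hcoeff ?_
  exact eq_zero_of_sum_mul_Gamma_eq_zero (m := n + 1 - d)
    (c := fun i => (-1) ^ (d + i) * (a (d + i)).coeff i) hz
    (fun j hj => hE.sum_coeff_mul_Gamma_eq_zero hS (by omega) hd) i (by omega)

lemma HasPowerEndpoint.le_two_mul_natTrailingDegree {s c : ℝ} (hE : HasPowerEndpoint I p s c)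
    (hS : IsSelfAdjointSystem n a I p) : n ≤ 2 * (a n).natTrailingDegree := by
  obtain ⟨k, hk, hmax⟩ := Finset.exists_max_image
    ((Finset.range (n + 1)).filter fun k => a k ≠ 0) (fun k => k - (a k).natTrailingDegree)
    ⟨n, by simp [hS.leading_ne_zero]⟩
  simp only [Finset.mem_filter, Finset.mem_range] at hk hmax
  have hdn := hmax n ⟨n.lt_succ_self, hS.leading_ne_zero⟩
  have hdvd : ∀ l ≤ n, X ^ (l - (k - (a k).natTrailingDegree)) ∣ a l := fun l hl => by
    by_cases hal : a l = 0
    · simp [hal]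
    · have := hmax l ⟨by omega, hal⟩
      exact (pow_dvd_pow X (by omega)).trans (X_pow_natTrailingDegree_dvd (a l))
  have hle : (a k).natTrailingDegree ≤ k :=
    (natTrailingDegree_le_natDegree _).trans (hS.natDegree_le (by omega))
  have hsum : k - (a k).natTrailingDegree + (a k).natTrailingDegree = k := by omega
  have key := hE.two_mul_le hS hdvd (i := (a k).natTrailingDegree) (by omega)
    (by rw [hsum]; exact trailingCoeff_nonzero_iff_nonzero.2 hk.2)
  omega

namespace IsSelfAdjointSystem

lemma exists_hasPowerEndpoint (hS : IsSelfAdjointSystem n a I p) (hIm : MeasurableSet I)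
    (hI : I ⊆ Set.Ici 0) (hI0 : I ∈ 𝓝[>] 0)
    (hreg : X ^ (a n).natTrailingDegree ∣ X * weightNum n a) :
    ∃ c, HasPowerEndpoint I p ((X * weightNum n a).coeff (a n).natTrailingDegree /
      (a n).coeff (a n).natTrailingDegree) c := by
  obtain ⟨δ, hδ, hs⟩ := hS.exists_isFormallySymmetricOn_Ioo hI0
  have hnear : ∀ {P : ℝ → Prop}, (∀ x ∈ Set.Ioo 0 δ, P x) → ∀ᶠ x in 𝓝[>] 0, P x :=
    fun h => mem_of_superset (Ioo_mem_nhdsGT hδ) h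
  obtain ⟨c, hc, hlim⟩ := exists_tendsto_mul_rpow
    (hnear fun x hx => (hs.contDiffOn.contDiffAt (hs.isOpen.mem_nhds hx)).differentiableAt
      (by simp))
    (hnear hs.pos) (hnear (hs.weight_ode hS.order_ne_zero hS.leading_ne_zero))
    (X_pow_natTrailingDegree_dvd (a n))
    (trailingCoeff_nonzero_iff_nonzero.2 hS.leading_ne_zero) hreg
  exact ⟨c, hIm, hI, hI0,
    neg_one_lt_of_integrableOn hI0 hc (by simpa using hS.weight.integrable 1) hlim, hc, hlim⟩

lemma hasEndpointMultiplicities_of_regular (hS : IsSelfAdjointSystem n a I p)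
    (hIm : MeasurableSet I) (hI : I ⊆ Set.Ici 0) (hI0 : I ∈ 𝓝[>] 0)
    (hreg : X ^ (a n).natTrailingDegree ∣ X * weightNum n a) :
    HasEndpointMultiplicities n a 0 := by
  obtain ⟨c, hE⟩ := hS.exists_hasPowerEndpoint hIm hI hI0 hreg
  have hle := hE.le_two_mul_natTrailingDegree hS
  have hn := hS.order_ne_zero
  have hs := hE.neg_one_lt
  rw [HasEndpointMultiplicities, rootMultiplicity_eq_natTrailingDegree' (p := a n)]
  refine ⟨hle, Or.inl ?_⟩
  obtain ⟨m, hm⟩ := Nat.exists_eq_succ_of_ne_zero (show (a n).natTrailingDegree ≠ 0 by omega)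
  have hα : (a n).coeff (m + 1) ≠ 0 := by
    rw [← Nat.succ_eq_add_one, ← hm]
    exact trailingCoeff_nonzero_iff_nonzero.2 hS.leading_ne_zero
  rw [hm] at hreg hs ⊢
  rw [coeff_X_mul] at hs
  refine congrArg (· + 1) (rootMultiplicity_zero_eq (fun i hi => ?_) ?_)
  · have hN : (weightNum n a).coeff i = 0 := by
      rw [← coeff_X_mul]; exact X_pow_dvd_iff.1 hreg _ (by omega)
    rw [coeff_pred_eq hn, hN, coeff_eq_zero_of_lt_natTrailingDegree (by omega), zero_mul, add_zero,
      mul_zero]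
  · rw [coeff_pred_eq hn]
    refine mul_ne_zero (by positivity) fun hzero => ?_
    have : (weightNum n a).coeff m / (a n).coeff (m + 1) = -(m + 1) := by
      rw [div_eq_iff hα]; linear_combination hzero
    rw [this] at hs
    linarith [m.cast_nonneg (α := ℝ)]

lemma eq_order_of_irregular (hS : IsSelfAdjointSystem n a I p) (hI0 : I ∈ 𝓝[>] 0)
    (hirr : ¬ X ^ (a n).natTrailingDegree ∣ X * weightNum n a) :
    (a n).natTrailingDegree = n ∧ (weightNum n a).natTrailingDegree + 2 = n := by
  obtain ⟨δ, hδ, hs⟩ := hS.exists_isFormallySymmetricOn_Ioo hI0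
  have hN : weightNum n a ≠ 0 := by
    rintro h
    simp [h] at hirr
  have hlt : (weightNum n a).natTrailingDegree + 1 < (a n).natTrailingDegree := by
    by_contra! hle
    refine hirr ((pow_dvd_pow X hle).trans ?_)
    rw [pow_succ']
    exact mul_dvd_mul_left X (X_pow_natTrailingDegree_dvd _)
  obtain ⟨κ, hκ⟩ := Nat.exists_eq_add_of_le hlt
  have hNlead : HasLeadingTerm (𝓝[>] 0) (fun x => x⁻¹)
      (-((a n).natTrailingDegree : ℤ) + (κ + 2 : ℕ)) ((weightNum n a).eval ·)
      (weightNum n a).trailingCoeff := by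
    have h := hasLeadingTerm_nhdsGT_zero (X_pow_natTrailingDegree_dvd (weightNum n a))
    rwa [show -((weightNum n a).natTrailingDegree : ℤ) =
      -((a n).natTrailingDegree : ℤ) + (κ + 2 : ℕ) by omega] at h
  have key := hs.two_mul_order_add_le hS.order_ne_zero isPlace_nhdsGT_zero (by omega)
    (Ioo_mem_nhdsGT hδ) (trailingCoeff_nonzero_iff_nonzero.2 hS.leading_ne_zero)
    (trailingCoeff_nonzero_iff_nonzero.2 hN)
    (hasLeadingTerm_nhdsGT_zero (X_pow_natTrailingDegree_dvd (a n))) hNlead (β := 0) (by omega)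
    fun k _ => ⟨_, by simpa using hasLeadingTerm_nhdsGT_zero (f := a k) (m := 0) (by simp)⟩
  have hmn : (a n).natTrailingDegree ≤ n :=
    (natTrailingDegree_le_natDegree _).trans (hS.natDegree_le le_rfl)
  have hκn : n * (κ + 2) ≤ 2 * (a n).natTrailingDegree := by
    zify
    push_cast at key
    linarith
  have hκ2 : κ + 2 ≤ 2 :=
    le_of_mul_le_mul_left (by linarith) (Nat.pos_of_ne_zero hS.order_ne_zero)
  obtain rfl : κ = 0 := by omega
  omega

lemma hasEndpointMultiplicities_zero (hS : IsSelfAdjointSystem n a I p) (hIm : MeasurableSet I)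
    (hI : I ⊆ Set.Ici 0) (hI0 : I ∈ 𝓝[>] 0) : HasEndpointMultiplicities n a 0 := by
  by_cases hreg : X ^ (a n).natTrailingDegree ∣ X * weightNum n a
  · exact hS.hasEndpointMultiplicities_of_regular hIm hI hI0 hreg
  obtain ⟨hA, hN⟩ := hS.eq_order_of_irregular hI0 hreg
  have hN0 : weightNum n a ≠ 0 := by
    rintro h
    simp [h] at hreg
  have hn := hS.order_ne_zero
  have hpred : (a (n - 1)).rootMultiplicity 0 = (weightNum n a).natTrailingDegree := by
    refine rootMultiplicity_zero_eq (fun i hi => ?_) ?_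
    · rw [coeff_pred_eq hn, coeff_eq_zero_of_lt_natTrailingDegree hi,
        coeff_eq_zero_of_lt_natTrailingDegree (by omega), zero_mul, add_zero, mul_zero]
    · rw [coeff_pred_eq hn, coeff_eq_zero_of_lt_natTrailingDegree (n := _ + 1) (by omega),
        zero_mul, add_zero]
      exact mul_ne_zero (by positivity) (trailingCoeff_nonzero_iff_nonzero.2 hN0)
  rw [HasEndpointMultiplicities, rootMultiplicity_eq_natTrailingDegree' (p := a n), hpred]
  omega

end IsSelfAdjointSystem

end Endpoint

section Affine

/-- The coefficients of `∑ a_k D ^ k` after the change of variable `x = c z + r`; each factor `c⁻¹`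
comes from `d/dx = c⁻¹ d/dz`. -/
noncomputable def affineCoeff (c r : ℝ) (a : ℕ → ℝ[X]) (k : ℕ) : ℝ[X] :=
  C (c⁻¹ ^ k) * (a k).comp (C c * X + C r)

variable {c : ℝ} {n : ℕ} {a : ℕ → ℝ[X]} {I : Set ℝ} {p : ℝ → ℝ}

lemma natDegree_affineCoeff (hc : c ≠ 0) (r : ℝ) (k : ℕ) :
    (affineCoeff c r a k).natDegree = (a k).natDegree := by
  rw [affineCoeff, natDegree_C_mul (pow_ne_zero _ (inv_ne_zero hc)), natDegree_comp,
    natDegree_linear hc, mul_one]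

lemma leadingCoeff_affineCoeff (hc : c ≠ 0) (r : ℝ) (k : ℕ) :
    (affineCoeff c r a k).leadingCoeff =
      c⁻¹ ^ k * ((a k).leadingCoeff * c ^ (a k).natDegree) := by
  rw [affineCoeff, leadingCoeff_mul, leadingCoeff_C,
    leadingCoeff_comp (by rw [natDegree_linear hc]; exact one_ne_zero), leadingCoeff_linear hc]

lemma affineCoeff_ne_zero (hc : c ≠ 0) (r : ℝ) {k : ℕ} (hk : a k ≠ 0) :
    affineCoeff c r a k ≠ 0 := by
  rw [← leadingCoeff_ne_zero, leadingCoeff_affineCoeff hc]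
  have := leadingCoeff_ne_zero.2 hk
  positivity

lemma rootMultiplicity_affineCoeff (hc : c ≠ 0) (r : ℝ) (k : ℕ) :
    (affineCoeff c r a k).rootMultiplicity 0 = (a k).rootMultiplicity r := by
  by_cases hk : a k = 0
  · simp [affineCoeff, hk]
  rw [affineCoeff, rootMultiplicity_mul (affineCoeff_ne_zero hc r hk), rootMultiplicity_C,
    rootMultiplicity_comp_C_mul_X_add_C _ _ _ _ hc.isUnit, mul_zero, zero_add, zero_add]

lemma hasEndpointMultiplicities_affineCoeff (hc : c ≠ 0) (r : ℝ) :
    HasEndpointMultiplicities n (affineCoeff c r a) 0 ↔ HasEndpointMultiplicities n a r := by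
  simp only [HasEndpointMultiplicities, rootMultiplicity_affineCoeff hc]

lemma weightNum_affineCoeff (hc : c ≠ 0) (r : ℝ) (hn : n ≠ 0) :
    weightNum n (affineCoeff c r a) =
      C (c⁻¹ ^ (n - 1)) * (weightNum n a).comp (C c * X + C r) := by
  obtain ⟨m, rfl⟩ := Nat.exists_eq_succ_of_ne_zero hn
  simp only [weightNum, affineCoeff, Nat.succ_eq_add_one, Nat.add_sub_cancel, derivative_mul,
    derivative_C, zero_mul, zero_add, derivative_comp, derivative_add, derivative_X, mul_one,
    add_zero, sub_comp, mul_comp, C_comp, pow_succ, C_mul]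
  have hcancel : C c⁻¹ * C c = (1 : ℝ[X]) := by rw [← C_mul, inv_mul_cancel₀ hc, C_1]
  linear_combination
    -C (c⁻¹ ^ m) * (derivative (a (m + 1))).comp (C c * X + C r) * hcancel

lemma leadingCoeff_weightNum_affineCoeff_div (hc : c ≠ 0) (r : ℝ) (hn : n ≠ 0)
    (hdeg : (weightNum n a).natDegree = (a n).natDegree) :
    (weightNum n (affineCoeff c r a)).leadingCoeff / (affineCoeff c r a n).leadingCoeff =
      c * ((weightNum n a).leadingCoeff / (a n).leadingCoeff) := by
  obtain ⟨m, rfl⟩ := Nat.exists_eq_succ_of_ne_zero hn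
  rw [weightNum_affineCoeff hc r hn, leadingCoeff_mul, leadingCoeff_C,
    leadingCoeff_comp (by rw [natDegree_linear hc]; exact one_ne_zero), leadingCoeff_linear hc,
    leadingCoeff_affineCoeff hc, hdeg, Nat.succ_sub_one, pow_succ]
  field_simp

lemma IsPolyDiffOpOfOrder.affine (hL : IsPolyDiffOpOfOrder n a) (hc : c ≠ 0) (r : ℝ) :
    IsPolyDiffOpOfOrder n (affineCoeff c r a) where
  leading_ne_zero := affineCoeff_ne_zero hc r hL.leading_ne_zero
  natDegree_le k hk := by rw [natDegree_affineCoeff hc]; exact hL.natDegree_le k hk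

lemma measurableEmbedding_affine (hc : c ≠ 0) (r : ℝ) :
    MeasurableEmbedding fun x : ℝ => c * x + r :=
  (affineHomeomorph c r hc).measurableEmbedding

lemma map_volume_affine (hc : c ≠ 0) (r : ℝ) :
    (volume : Measure ℝ).map (fun x => c * x + r) = ENNReal.ofReal |c⁻¹| • volume := by
  have hcomp : (fun x : ℝ => c * x + r) = (· + r) ∘ (c * ·) := rfl
  rw [hcomp, ← Measure.map_map (measurable_add_const r) (measurable_const_mul c),
    Real.map_volume_mul_left hc, Measure.map_smul, map_add_right_eq_self]

lemma setIntegral_affine (hc : c ≠ 0) (r : ℝ) (F : ℝ → ℝ) :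
    ∫ x in (fun x => c * x + r) ⁻¹' I, F (c * x + r) = |c⁻¹| * ∫ x in I, F x := by
  rw [← (measurableEmbedding_affine hc r).setIntegral_map F I, map_volume_affine hc,
    Measure.restrict_smul, integral_smul_measure, ENNReal.toReal_ofReal (abs_nonneg _), smul_eq_mul]

lemma integrableOn_affine (hc : c ≠ 0) (r : ℝ) {F : ℝ → ℝ} (hF : IntegrableOn F I) :
    IntegrableOn (fun x => F (c * x + r)) ((fun x => c * x + r) ⁻¹' I) := by
  refine (measurableEmbedding_affine hc r).integrableOn_map_iff.1 ?_
  rw [map_volume_affine hc, IntegrableOn, Measure.restrict_smul]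
  exact hF.smul_measure ENNReal.ofReal_ne_top

lemma inv_mul_affine_sub (hc : c ≠ 0) (r x : ℝ) : c⁻¹ * (c * x + r - r) = x := by
  rw [add_sub_cancel_right, inv_mul_cancel_left₀ hc]

lemma IsAdmissibleWeight.affine (hp : IsAdmissibleWeight I p) (hc : c ≠ 0) (r : ℝ) :
    IsAdmissibleWeight ((fun x => c * x + r) ⁻¹' I) (fun x => p (c * x + r)) where
  piecewise_smooth_pos := by
    obtain ⟨S, hS, hsm, hpos⟩ := hp.piecewise_smooth_pos
    exact ⟨(fun x => c * x + r) ⁻¹' S,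
      hS.preimage (measurableEmbedding_affine hc r).injective.injOn,
      hsm.comp (by fun_prop) fun _ hx => hx, fun x hx => hpos _ hx⟩
  integrable u := by
    have h := integrableOn_affine hc r (hp.integrable (u.comp (C c⁻¹ * (X - C r))))
    simpa only [eval_comp, eval_mul, eval_C, eval_sub, eval_X, inv_mul_affine_sub hc] using h

lemma iteratedDeriv_comp_affine {y : ℝ → ℝ} {k : ℕ} (hy : ContDiff ℝ k y) (c r x : ℝ) :
    iteratedDeriv k (fun x => y (c * x + r)) x = c ^ k * iteratedDeriv k y (c * x + r) := by
  have h := iteratedDeriv_comp_const_mul (f := fun z => y (z + r)) (by fun_prop) c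
  rw [h, iteratedDeriv_comp_add_const]

lemma polyDiffOp_affine (hc : c ≠ 0) (r : ℝ) {y : ℝ → ℝ} (hy : ContDiff ℝ ∞ y) (x : ℝ) :
    polyDiffOp n (affineCoeff c r a) (fun x => y (c * x + r)) x =
      polyDiffOp n a y (c * x + r) := by
  refine Finset.sum_congr rfl fun k _ => ?_
  rw [iteratedDeriv_comp_affine (hy.of_le (by exact_mod_cast le_top)), affineCoeff, eval_mul,
    eval_C, eval_comp, eval_add, eval_mul, eval_C, eval_X, eval_C, inv_pow]
  field_simp

lemma IsSelfAdjointFor.affine (hsa : IsSelfAdjointFor n a I p) (hc : c ≠ 0) (r : ℝ) :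
    IsSelfAdjointFor n (affineCoeff c r a) ((fun x => c * x + r) ⁻¹' I)
      (fun x => p (c * x + r)) := by
  intro y u hy hu
  have hinv : ∀ {v : ℝ → ℝ}, Function.HasTemperateGrowth v →
      Function.HasTemperateGrowth fun z => v (c⁻¹ * (z - r)) := fun hv => hv.comp (by fun_prop)
  have hop : ∀ {v : ℝ → ℝ}, Function.HasTemperateGrowth v → ∀ x,
      polyDiffOp n (affineCoeff c r a) v x =
        polyDiffOp n a (fun z => v (c⁻¹ * (z - r))) (c * x + r) := fun hv x => by
    rw [← polyDiffOp_affine hc r (hinv hv).1]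
    simp only [inv_mul_affine_sub hc]
  have hleft := setIntegral_affine (I := I) hc r fun x =>
    p x * polyDiffOp n a (fun z => y (c⁻¹ * (z - r))) x * u (c⁻¹ * (x - r))
  have hright := setIntegral_affine (I := I) hc r fun x =>
    p x * y (c⁻¹ * (x - r)) * polyDiffOp n a (fun z => u (c⁻¹ * (z - r))) x
  have hsymm := hsa _ _ (hinv hy) (hinv hu)
  simp only [inv_mul_affine_sub hc] at hleft hright
  simp only [weightedInner, hop hy, hop hu] at hsymm ⊢
  rw [hleft, hright, hsymm]

lemma IsSelfAdjointSystem.affine (hS : IsSelfAdjointSystem n a I p) (hc : c ≠ 0) (r : ℝ) :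
    IsSelfAdjointSystem n (affineCoeff c r a) ((fun x => c * x + r) ⁻¹' I)
      (fun x => p (c * x + r)) where
  order := hS.order.affine hc r
  coeff_zero := by rw [affineCoeff, hS.coeff_zero, zero_comp, mul_zero]
  weight := hS.weight.affine hc r
  selfAdjoint := hS.selfAdjoint.affine hc r

end Affine

lemma sum_rootMultiplicity_le {R : Type*} [CommRing R] [IsDomain R] (f : R[X]) (s : Finset R) :
    ∑ x ∈ s, f.rootMultiplicity x ≤ f.natDegree := by
  classical
  simp_rw [← count_roots]
  refine le_trans ?_ f.card_roots'
  rw [← Multiset.sum_count_eq_card (s := s ∪ f.roots.toFinset) (m := f.roots) fun x hx =>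
    Finset.mem_union_right s (Multiset.mem_toFinset.2 hx)]
  exact Finset.sum_le_sum_of_subset Finset.subset_union_left

namespace IsSelfAdjointSystem

variable {n : ℕ} {a : ℕ → ℝ[X]} {I : Set ℝ} {p : ℝ → ℝ} {r R₀ c d : ℝ}

lemma hasEndpointMultiplicities_of_affine (hS : IsSelfAdjointSystem n a I p)
    (hIm : MeasurableSet I) (hc : c ≠ 0) (hI : ∀ x, c * x + r ∈ I → 0 ≤ x)
    (hIr : ∀ᶠ x in 𝓝[>] 0, c * x + r ∈ I) : HasEndpointMultiplicities n a r :=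
  (hasEndpointMultiplicities_affineCoeff hc r).1
    ((hS.affine hc r).hasEndpointMultiplicities_zero
      ((measurableEmbedding_affine hc r).measurable hIm) hI hIr)

lemma hasEndpointMultiplicities_left (hS : IsSelfAdjointSystem n a I p) (hIm : MeasurableSet I)
    (hI : I ⊆ Set.Ici r) (hIr : I ∈ 𝓝[>] r) : HasEndpointMultiplicities n a r := by
  obtain ⟨d, hd, hsub⟩ := mem_nhdsGT_iff_exists_Ioo_subset.1 hIr
  refine hS.hasEndpointMultiplicities_of_affine hIm one_ne_zero
    (fun x hx => by simpa using hI hx) ?_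
  filter_upwards [Ioo_mem_nhdsGT (sub_pos.2 hd)] with x hx
  exact hsub ⟨by linarith [hx.1], by linarith [hx.2]⟩

lemma hasEndpointMultiplicities_right (hS : IsSelfAdjointSystem n a I p) (hIm : MeasurableSet I)
    (hI : I ⊆ Set.Iic r) (hIr : I ∈ 𝓝[<] r) : HasEndpointMultiplicities n a r := by
  obtain ⟨d, hd, hsub⟩ := mem_nhdsLT_iff_exists_Ioo_subset.1 hIr
  refine hS.hasEndpointMultiplicities_of_affine hIm (neg_ne_zero.2 one_ne_zero)
    (fun x hx => by simpa using hI hx) ?_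
  filter_upwards [Ioo_mem_nhdsGT (sub_pos.2 hd)] with x hx
  exact hsub ⟨by linarith [hx.2], by linarith [hx.1]⟩

lemma reflect (hS : IsSelfAdjointSystem n a I p) :
    IsSelfAdjointSystem n (affineCoeff (-1) 0 a) ((fun x => -1 * x + 0) ⁻¹' I)
      (fun x => p (-1 * x + 0)) :=
  hS.affine (neg_ne_zero.2 one_ne_zero) 0

lemma two_mul_natDegree_leading_le_of_Iio (hS : IsSelfAdjointSystem n a I p)
    (hI : Set.Iio R₀ ⊆ I) : 2 * (a n).natDegree ≤ n := by
  rw [← natDegree_affineCoeff (neg_ne_zero.2 one_ne_zero) 0 n]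
  refine hS.reflect.two_mul_natDegree_leading_le (R₀ := -R₀) fun x (hx : -R₀ < x) => hI ?_
  simpa using neg_lt.1 hx

/-- The logarithmic derivative `N / a_n` of the weight would tend to a negative limit at `+∞` and
to a positive one at `-∞`, yet a quotient of polynomials of equal degrees has the same limit at
both ends. -/
lemma natDegree_leading_eq_zero_of_univ (hS : IsSelfAdjointSystem n a Set.univ p) :
    (a n).natDegree = 0 := by
  by_contra hdeg
  have hneg : (-1 : ℝ) ≠ 0 := neg_ne_zero.2 one_ne_zero
  obtain ⟨hN, hright⟩ := hS.weightNum_leading_of_unbounded (Set.subset_univ (Set.Ioi 0)) hdeg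
  obtain ⟨-, hleft⟩ := hS.reflect.weightNum_leading_of_unbounded
    (Set.subset_univ (Set.Ioi 0)) (by rwa [natDegree_affineCoeff hneg])
  rw [leadingCoeff_weightNum_affineCoeff_div hneg 0 hS.order_ne_zero hN] at hleft
  linarith

lemma hasEndpointMultiplicities_of_bounded (hS : IsSelfAdjointSystem n a I p)
    (hIm : MeasurableSet I) (hcd : c < d) (hsub : Set.Ioo c d ⊆ I) (hsup : I ⊆ Set.Icc c d)
    (hr : (a n).IsRoot r) : HasEndpointMultiplicities n a r := by
  have hc := hS.hasEndpointMultiplicities_left hIm (fun x hx => (hsup hx).1)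
    (mem_of_superset (Ioo_mem_nhdsGT hcd) hsub)
  have hd := hS.hasEndpointMultiplicities_right hIm (fun x hx => (hsup hx).2)
    (mem_of_superset (Ioo_mem_nhdsLT hcd) hsub)
  have hrpos := (rootMultiplicity_pos hS.leading_ne_zero).2 hr
  by_cases hrc : r = c
  · rwa [hrc]
  by_cases hrd : r = d
  · rwa [hrd]
  have hsum := sum_rootMultiplicity_le (a n) {r, c, d}
  rw [Finset.sum_insert (by simp [hrc, hrd]), Finset.sum_pair hcd.ne] at hsum
  have := hS.natDegree_le le_rfl
  have := hc.1
  have := hd.1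
  omega

lemma eq_of_isRoot_of_two_mul_natDegree_le (hS : IsSelfAdjointSystem n a I p)
    (hdeg : 2 * (a n).natDegree ≤ n) (hc : HasEndpointMultiplicities n a c)
    (hr : (a n).IsRoot r) : r = c := by
  by_contra hrc
  have hsum := sum_rootMultiplicity_le (a n) {r, c}
  rw [Finset.sum_pair hrc] at hsum
  have hrpos := (rootMultiplicity_pos hS.leading_ne_zero).2 hr
  have := hc.1
  omega

theorem hasEndpointMultiplicities_of_isRoot (hS : IsSelfAdjointSystem n a I p)
    (hI : I.OrdConnected) (hI' : I.Nontrivial) (hr : (a n).IsRoot r) :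
    HasEndpointMultiplicities n a r := by
  have hIm := hI.measurableSet
  have hpre := hI.isPreconnected
  by_cases hb : BddBelow I <;> by_cases ht : BddAbove I
  · obtain ⟨x, hx, y, hy, hxy⟩ := hI'.exists_lt
    exact hS.hasEndpointMultiplicities_of_bounded hIm
      ((csInf_le hb hx).trans_lt (hxy.trans_le (le_csSup ht hy)))
      (IsConnected.Ioo_csInf_csSup_subset ⟨hI'.nonempty, hpre⟩ hb ht)
      (subset_Icc_csInf_csSup hb ht) hr
  · have hsub := hpre.Ioi_csInf_subset hb ht
    have hend := hS.hasEndpointMultiplicities_left hIm (fun x hx => csInf_le hb hx)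
      (mem_of_superset self_mem_nhdsWithin hsub)
    rwa [hS.eq_of_isRoot_of_two_mul_natDegree_le (hS.two_mul_natDegree_leading_le hsub) hend hr]
  · have hsub := hpre.Iio_csSup_subset hb ht
    have hend := hS.hasEndpointMultiplicities_right hIm (fun x hx => le_csSup ht hx)
      (mem_of_superset self_mem_nhdsWithin hsub)
    rwa [hS.eq_of_isRoot_of_two_mul_natDegree_le
      (hS.two_mul_natDegree_leading_le_of_Iio hsub) hend hr]
  · obtain rfl := hpre.eq_univ_of_unbounded hb ht
    have hrpos := (rootMultiplicity_pos hS.leading_ne_zero).2 hr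
    have hle := sum_rootMultiplicity_le (a n) {r}
    rw [Finset.sum_singleton, hS.natDegree_leading_eq_zero_of_univ] at hle
    omega

end IsSelfAdjointSystem

lemma isSelfAdjointSystem_update {n : ℕ} (hn : n ≠ 0) {a : ℕ → ℝ[X]} {I : Set ℝ} {p : ℝ → ℝ}
    (hL : IsPolyDiffOpOfOrder n a) (hp : IsAdmissibleWeight I p)
    (hsa : IsSelfAdjointFor n a I p) : IsSelfAdjointSystem n (Function.update a 0 0) I p := by
  have hupd : ∀ k, k ≠ 0 → Function.update a 0 0 k = a k := fun k hk =>
    Function.update_of_ne hk _ _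
  have hIcc : ∀ k ∈ Finset.Icc 1 n, k ≠ 0 := fun k hk =>
    Nat.one_le_iff_ne_zero.1 (Finset.mem_Icc.1 hk).1
  have hop : polyDiffOp n (Function.update a 0 0) = polyDiffOp n a := by
    ext y x
    exact Finset.sum_congr rfl fun k hk => by rw [hupd k (hIcc k hk)]
  refine ⟨⟨?_, fun k hk => ?_⟩, Function.update_self .., hp, ?_⟩
  · rw [hupd n hn]; exact hL.leading_ne_zero
  · rw [hupd k (hIcc k hk)]; exact hL.natDegree_le k hk
  · rw [IsSelfAdjointFor, hop]; exact hsa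

theorem proposition3p4 (n : ℕ) (hn : 2 < n) (a : ℕ → ℝ[X]) (hL : IsPolyDiffOpOfOrder n a)
    (I : Set ℝ) (hI : I.OrdConnected) (hI' : I.Nontrivial)
    (p : ℝ → ℝ) (hp : IsAdmissibleWeight I p) (hsa : IsSelfAdjointFor n a I p)
    (r : ℝ) (hr : (a n).IsRoot r) :
    2 ≤ (a n).rootMultiplicity r ∧
      0 < (a (n - 1)).rootMultiplicity r ∧
      (a (n - 1)).rootMultiplicity r < (a n).rootMultiplicity r := by
  have hS := isSelfAdjointSystem_update (by omega) hL hp hsa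
  have hupd : ∀ k, k ≠ 0 → Function.update a 0 0 k = a k := fun k hk =>
    Function.update_of_ne hk _ _
  have hr' : (Function.update a 0 0 n).IsRoot r := by rwa [hupd n (by omega)]
  obtain ⟨hmult, halt⟩ := hS.hasEndpointMultiplicities_of_isRoot hI hI' hr'
  rw [hupd n (by omega)] at hmult halt
  rw [hupd (n - 1) (by omega)] at halt
  omega
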